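/- **Setting.** Let $G$ be a countable discrete group and let $\mathcal T=(C_n,F_{n-1},\kappa_n,\nu_{n-1})_{n=1}^\infty$ be a sequence of $(C,F)$-parameters: $C_n,F_n\subset G$ are finite sets with $F_0=\{1\}$, $1\in F_n\cap C_n$, $\#C_n>1$, $F_nC_{n+1}\subset F_{n+1}$ and $F_nc\cap F_nc'=\emptyset$ for distinct $c,c'\in C_{n+1}$; $\kappa_n$ is a probability measure on $C_n$ charging every point, with $\prod_{n\ge1}\max_{c\in C_n}\kappa_n(c)=0$; $\nu_n$ is a finite measure on $F_n$ charging every point, with $\nu_0=\delta_1$ and $\nu_{n+1}(fc)=\nu_n(f)\kappa_{n+1}(c)$ for $f\in F_n$, $c\in C_{n+1}$; and $\lim_{m\to\infty}\nu_m\big((F_nC_{n+1}\cdots C_m)\cap g^{-1}F_m\big)=\nu_n(F_n)$ for all $g\in G$, $n\ge0$. Let $X$ be the inductive limit of the spaces $X_n=F_n\times C_{n+1}\times C_{n+2}\times\cdots$ along the embeddings $(f,c_{n+1},c_{n+2},\dots)\mapsto(fc_{n+1},c_{n+2},\dots)$ of $X_n$ into $X_{n+1}$. Let $\mu$ be the $\sigma$-finite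 Borel measure on $X$ whose restriction to each $X_n$ is $\nu_n\otimes\kappa_{n+1}\otimes\kappa_{n+2}\otimes\cdots$. The nonsingular $(C,F)$-action $T=(T_g)_{g\in G}$ associated with $\mathcal T$ is defined $\mu$-almost everywhere on $X$ by $T_g(f,c_{n+1},c_{n+2},\dots)=(gf,c_{n+1},c_{n+2},\dots)$ if $f,gf\in F_n$. By an *odometer sequence* we mean a sequence $\Gamma_1\supsetneq\Gamma_2\supsetneq\cdots$ of finite index subgroups of $G$ with $\bigcap_{n}\bigcap_{g\in G}g\Gamma_ng^{-1}=\{1\}$. A *nonsingular odometer* is the projective limit $Y=\varprojlim G/\Gamma_n$ of such a sequence with the action of $G$ by left translations, endowed with a nonzero $\sigma$-finite Borel measure $\nu$ that is quasi-invariant and ergodic. It is a *factor* of $T$ if there is a measurable map $\pi:X\to Y$ such that, for every $g\in G$, $\pi(T_gx)=g\pi(x)$ for $\mu$-a.e. $x$, and such that $\mu\circ\pi^{-1}$ and $\nu$ have the same null sets. **Corollary 4.6.** The following are equivalent: 1. $T$ has no nonsingular odometer factor; 2. for each odometer sequence $(\Gamma_n)_{n\ge1}$ no telescoping of $\mathcal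 T$ is compatible with $(\Gamma_n)_{n\ge1}$, i.e. for all integers $0=q_0<q_1<q_2<\cdots$, $$\sum_{n=1}^\infty\big(\kappa_{q_{n-1}+1}*\cdots*\kappa_{q_n}\big)\big(\{c\in C_{q_{n-1}+1}\cdots C_{q_n}\mid c\notin\Gamma_n\}\big)=\infty.$$ Moreover, if $\bigcap_n\Gamma_n$ is finite for every odometer sequence in $G$ (for example, if $G$ is Abelian), then 2 is also equivalent to 1'. $T$ has no nonsingular odometer factor with a non-atomic measure $\nu$. **Corollary 4.7.** For an increasing sequence of integers $0=q_0<q_1<\cdots$, the $\boldsymbol q$-telescoping of $\mathcal T$ consists of $\widetilde C_n=C_{q_{n-1}+1}\cdots C_{q_n}$, $\widetilde F_n=F_{q_n}$, $\widetilde\kappa_n=\kappa_{q_{n-1}+1}*\cdots*\kappa_{q_n}$, $\widetilde\nu_n=\nu_{q_n}$; it is compatible with $(\Gamma_n)_{n\ge1}$ if $\sum_{n\ge1}\widetilde\kappa_n(\{c\in\widetilde C_n\mid c\notin\Gamma_n\})<\infty$. $T$ is isomorphic to a nonsingular odometer $(Y,\nu)$ if there is a map $\pi$ as in the definition of a factor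 which is invertible modulo null sets. Consider the conditions: 3. $T$ is not isomorphic to any nonsingular odometer; 4. for each odometer sequence $(\Gamma_n)_{n\ge1}$ and all $0=q_0<q_1<\cdots$ such that the $\boldsymbol q$-telescoping of $\mathcal T$ is compatible with $(\Gamma_n)_{n\ge1}$, there are $n>0$ and $\epsilon_0>0$ such that for all $l>0$, $D_l\subset G/\Gamma_l$ and $M>n$ there is $m>M$ with $$\widetilde\nu_m\Big(\widetilde C_{n+1}\cdots\widetilde C_m\,\triangle\,\{f\in\widetilde F_m\mid f\Gamma_l\in D_l\}\Big)>\epsilon_0 .$$ Then 3 implies 4. If $\mu(X)=\lim_{n\to\infty}\nu_n(F_n)<\infty$, then 3 and 4 are equivalent. -/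

import Mathlib

open MeasureTheory Filter Topology
open scoped ENNReal Pointwise

/-- The ordered product `C n * C (n+1) * ⋯ * C (m-1)` of subsets of `G`
(it is `{1}` if `m ≤ n`). -/
def blockSet {G : Type*} [Group G] (C : ℕ → Set G) (n : ℕ) : ℕ → Set G
  | 0 => 1
  | m + 1 => if n ≤ m then blockSet C n m * C m else 1

/-- The ordered convolution `κ n * κ (n+1) * ⋯ * κ (m-1)` of measures on `G`
(it is the Dirac measure at `1` if `m ≤ n`). -/
noncomputable def blockConv {G : Type*} [Group G] [MeasurableSpace G]
    (κ : ℕ → Measure G) (n : ℕ) : ℕ → Measure G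
  | 0 => Measure.dirac 1
  | m + 1 => if n ≤ m then (blockConv κ n m).mconv (κ m) else Measure.dirac 1

/-- A sequence of quadruples of `(C,F)`-parameters.  The sets `C n` and the measures `κ n` are
indexed from `0`: `C n` and `κ n` here are usually denoted `C_{n+1}` and `κ_{n+1}`. -/
structure CFData (G : Type*) [MeasurableSpace G] where
  /-- `C n` stands for `C_{n+1}` -/
  C : ℕ → Set G
  /-- `F n` stands for `F_n` -/
  F : ℕ → Set G
  /-- `κ n` stands for `κ_{n+1}`, a measure on `G` supported on `C n` -/
  κ : ℕ → Measure G
  /-- `ν n` stands for `ν_n`, a measure on `G` supported on `F n` -/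
  ν : ℕ → Measure G

namespace CFData

variable {G : Type*} [Group G] [MeasurableSpace G]

/-- The standing conditions on the parameters of a nonsingular `(C,F)`-action. -/
structure IsAdmissible (P : CFData G) : Prop where
  finite_C : ∀ n, (P.C n).Finite
  finite_F : ∀ n, (P.F n).Finite
  F_zero : P.F 0 = {1}
  one_mem_F : ∀ n, 1 ∈ P.F n
  one_mem_C : ∀ n, 1 ∈ P.C n
  nontrivial_C : ∀ n, (P.C n).Nontrivial
  mul_subset : ∀ n, P.F n * P.C n ⊆ P.F (n + 1)
  disjoint : ∀ n, ∀ c ∈ P.C n, ∀ c' ∈ P.C n, c ≠ c' →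
    Disjoint (P.F n * {c}) (P.F n * {c'})
  /-- `κ n` is a non-degenerate probability measure on `C n`. -/
  prob_κ : ∀ n, IsProbabilityMeasure (P.κ n)
  κ_compl : ∀ n, P.κ n (P.C n)ᶜ = 0
  κ_pos : ∀ n, ∀ c ∈ P.C n, P.κ n {c} ≠ 0
  /-- the infinite product of the `κ n` has no atoms -/
  nonatomic : Tendsto (fun N => ∏ n ∈ Finset.range N, ⨆ c ∈ P.C n, P.κ n {c}) atTop (𝓝 0)
  /-- `ν n` is a non-degenerate finite measure on `F n`. -/
  finite_ν : ∀ n, IsFiniteMeasure (P.ν n)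
  ν_compl : ∀ n, P.ν n (P.F n)ᶜ = 0
  ν_pos : ∀ n, ∀ f ∈ P.F n, P.ν n {f} ≠ 0
  ν_zero : P.ν 0 = Measure.dirac 1
  ν_succ : ∀ n, ∀ f ∈ P.F n, ∀ c ∈ P.C n, P.ν (n + 1) {f * c} = P.ν n {f} * P.κ n {c}
  /-- the domain `X^G` of the action is conull -/
  conull : ∀ (g : G) (n : ℕ),
    Tendsto (fun m => P.ν m ((P.F n * blockSet P.C n m) ∩ {x | g * x ∈ P.F m})) atTop
      (𝓝 (P.ν n (P.F n)))

/-! ### The space -/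

/-- The sequence whose `m`-th term, for `m ≥ n`, is `f * c n * c (n+1) * ⋯ * c (m-1)`:
the `F m`-coordinate of the point `(f, c n, c (n+1), …)` of `X_n` after it is moved to `X_m`. -/
def path (f : G) (c : ℕ → G) (n : ℕ) : ℕ → G
  | 0 => f
  | m + 1 => if n ≤ m then path f c n m * c m else f

/-- A germ at infinity of sequences in `G` is a point of the `(C,F)`-space if it is the germ of
the sequence of `F m`-coordinates of some point of some `X_n = F n × C n × C (n+1) × ⋯`. -/
def IsPoint (P : CFData G) (x : Germ (atTop : Filter ℕ) G) : Prop :=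
  ∃ (n : ℕ) (f : P.F n) (c : ∀ k, P.C k), x = (path (f : G) (fun k => (c k : G)) n : ℕ → G)

/-- The `(C,F)`-space `X`, the inductive limit of the spaces `X_n = F n × C n × C (n+1) × ⋯`
along the embeddings `(f, c n, c (n+1), …) ↦ (f * c n, c (n+1), …)` of `X_n` into `X_{n+1}`.
Two points `(f, c n, …) ∈ X_n` and `(f', c' n', …) ∈ X_{n'}` are identified in the limit exactly if
their `F m`-coordinates agree for all large `m`; so a point of `X` is recorded as the germ at
infinity of the sequence of its `F m`-coordinates. -/
@[ext]
structure Space (P : CFData G) where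
  /-- the germ at infinity of the sequence of `F m`-coordinates -/
  germ : Germ (atTop : Filter ℕ) G
  isPoint : P.IsPoint germ

/-- The point of `X` given by `(f, c n, c (n+1), …) ∈ X_n`. The entries `c k` with `k < n` are
dummies, which have no influence on the result. -/
def point (P : CFData G) (n : ℕ) (z : P.F n × (∀ k, P.C k)) : P.Space :=
  ⟨(path (z.1 : G) (fun k => (z.2 k : G)) n : ℕ → G), n, z.1, z.2, rfl⟩

/-- The cylinder `[a]_n`: the points `(a, c n, c (n+1), …)` of `X_n` with first coordinate `a`. -/
def cylinder (P : CFData G) (n : ℕ) (a : P.F n) : Set P.Space :=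
  {x | ∃ c : ∀ k, P.C k, x = P.point n (a, c)}

/-- The Borel structure of `X`: the (countably many) cylinders form a base of the topology. -/
instance (P : CFData G) : MeasurableSpace P.Space :=
  MeasurableSpace.generateFrom {A | ∃ (n : ℕ) (a : P.F n), A = P.cylinder n a}

/-! ### The action -/

open Classical in
/-- The transformation `T_g` of the `(C,F)`-space. If `x = (f, c n, c (n+1), …) ∈ X_n` and
`g * f ∈ F n` for some `n`, then `T_g x = (g * f, c n, c (n+1), …)`; on the remaining set
`X \ X^g`, where the action is undefined and which is null, the convention is `T_g x = x`. -/
noncomputable def T (P : CFData G) (g : G) (x : P.Space) : P.Space :=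
  if h : P.IsPoint (x.germ.map (fun s => g * s)) then ⟨x.germ.map (fun s => g * s), h⟩ else x

theorem T_point (P : CFData G) (g : G) (n : ℕ) (f : P.F n) (c : ∀ k, P.C k)
    (h : g * (f : G) ∈ P.F n) : P.T g (P.point n (f, c)) = P.point n (⟨g * f, h⟩, c) := by
  have mul_path : ∀ m, g * path (f : G) (fun k => (c k : G)) n m =
      path (g * (f : G)) (fun k => (c k : G)) n m := by
    intro m
    induction m with
    | zero => rfl
    | succ m ih =>
      simp only [path]
      split_ifs
      · rw [← mul_assoc, ih]
      · rfl
  have key : (P.point n (f, c)).germ.map (fun s => g * s) =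
      (P.point n (⟨g * f, h⟩, c)).germ := by
    simp only [point, Germ.map_coe]
    congr 1
    funext m
    exact mul_path m
  have hp : P.IsPoint ((P.point n (f, c)).germ.map (fun s => g * s)) := by
    rw [key]
    exact (P.point n (⟨g * f, h⟩, c)).isPoint
  unfold T
  rw [dif_pos hp]
  simp only [key]

/-! ### The measure -/

/-- `κ n` as a measure on the set `C n`. -/
noncomputable def κC (P : CFData G) (n : ℕ) : Measure (P.C n) :=
  (P.κ n).comap Subtype.val

/-- `ν n` as a measure on the set `F n`. -/
noncomputable def νF (P : CFData G) (n : ℕ) : Measure (P.F n) :=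
  (P.ν n).comap Subtype.val

theorem isProbabilityMeasure_κC [DiscreteMeasurableSpace G] {P : CFData G}
    (hP : P.IsAdmissible) (n : ℕ) : IsProbabilityMeasure (P.κC n) := by
  have := hP.prob_κ n
  refine (MeasurableEmbedding.subtype_coe
    (MeasurableSet.of_discrete (s := P.C n))).isProbabilityMeasure_comap ?_
  rw [Subtype.range_coe]
  exact hP.κ_compl n

/-- The part of `F n` that the embedding of `X_{n-1}` into `X_n` does not reach:
`F 0` for `n = 0`, and `F n \ F (n-1) * C (n-1)` for `n ≥ 1`. -/
def newF (P : CFData G) : (n : ℕ) → Set (P.F n)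
  | 0 => Set.univ
  | n + 1 => {f | (f : G) ∉ P.F n * P.C n}

/-- The nonsingular `(C,F)`-measure on `X`. The space `X` is the disjoint union of `X_0` and of the
sets `X_n \ X_{n-1}`, `n ≥ 1`, and the measure is equal to the product `ν n ⊗ κ n ⊗ κ (n+1) ⊗ ⋯` on
the `n`-th of these sets. -/
noncomputable def measure [DiscreteMeasurableSpace G] (P : CFData G) (hP : P.IsAdmissible) :
    Measure P.Space :=
  haveI := isProbabilityMeasure_κC hP
  Measure.sum fun n =>
    (((P.νF n).restrict (P.newF n)).prod (Measure.infinitePi fun k => P.κC k)).map (P.point n)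

/-! ### The measure of a cylinder -/

section Cylinder

variable {G : Type*} [Group G]

theorem path_of_le (f : G) (c : ℕ → G) {n m : ℕ} (h : m ≤ n) : path f c n m = f := by
  cases m with
  | zero => rfl
  | succ m => rw [path, if_neg (by omega)]

theorem path_succ (f : G) (c : ℕ → G) {n m : ℕ} (h : n ≤ m) :
    path f c n (m + 1) = path f c n m * c m := by
  rw [path, if_pos h]

theorem path_path (f : G) (c : ℕ → G) {n j m : ℕ} (h : n ≤ j) (h' : j ≤ m) :
    path (path f c n j) c j m = path f c n m := by
  induction m, h' using Nat.le_induction with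
  | base => exact path_of_le _ _ le_rfl
  | succ m hm ih => rw [path_succ _ _ hm, ih, path_succ _ _ (h.trans hm)]

theorem path_congr (f : G) {c d : ℕ → G} {n m : ℕ} (h : ∀ k, n ≤ k → k < m → c k = d k) :
    path f c n m = path f d n m := by
  induction m with
  | zero => rfl
  | succ m ih =>
    simp only [path]
    split_ifs with hn
    · rw [ih fun k h1 h2 => h k h1 (by omega), h m hn (by omega)]
    · rfl

variable [MeasurableSpace G] {P : CFData G}

theorem path_mem (hP : P.IsAdmissible) {n m : ℕ} (h : n ≤ m) (f : P.F n) (c : ∀ k, P.C k) :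
    path (f : G) (fun k => (c k : G)) n m ∈ P.F m := by
  induction m, h using Nat.le_induction with
  | base => rw [path_of_le _ _ le_rfl]; exact f.2
  | succ m hm ih =>
    rw [path_succ _ _ hm]
    exact hP.mul_subset m (Set.mul_mem_mul ih (c m).2)

theorem mul_unique (hP : P.IsAdmissible) {n : ℕ} {a b c d : G} (ha : a ∈ P.F n) (hb : b ∈ P.F n)
    (hc : c ∈ P.C n) (hd : d ∈ P.C n) (h : a * c = b * d) : a = b ∧ c = d := by
  have hcd : c = d := by
    by_contra hne
    refine Set.disjoint_left.1 (hP.disjoint n c hc d hd hne)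
      (Set.mul_mem_mul ha (Set.mem_singleton c)) ?_
    rw [h]
    exact Set.mul_mem_mul hb (Set.mem_singleton d)
  subst hcd
  exact ⟨mul_right_cancel h, rfl⟩

theorem path_unique (hP : P.IsAdmissible) {n m : ℕ} (h : n ≤ m) (f f' : P.F n)
    (c c' : ∀ k, P.C k)
    (e : path (f : G) (fun k => (c k : G)) n m = path (f' : G) (fun k => (c' k : G)) n m) :
    f = f' ∧ ∀ k, n ≤ k → k < m → c k = c' k := by
  induction m, h using Nat.le_induction with
  | base =>
    rw [path_of_le _ _ le_rfl, path_of_le _ _ le_rfl] at e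
    exact ⟨Subtype.ext e, fun k h1 h2 => by omega⟩
  | succ m hm ih =>
    rw [path_succ _ _ hm, path_succ _ _ hm] at e
    obtain ⟨h1, h2⟩ := mul_unique hP (path_mem hP hm f c) (path_mem hP hm f' c') (c m).2 (c' m).2 e
    obtain ⟨h3, h4⟩ := ih h1
    refine ⟨h3, fun k hk hk' => ?_⟩
    rcases Nat.lt_succ_iff_lt_or_eq.1 hk' with hlt | rfl
    · exact h4 k hk hlt
    · exact Subtype.ext h2

theorem point_eq_iff (n j : ℕ) (z : P.F n × (∀ k, P.C k)) (w : P.F j × (∀ k, P.C k)) :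
    P.point n z = P.point j w ↔ ∀ᶠ m in atTop,
      path (z.1 : G) (fun k => (z.2 k : G)) n m = path (w.1 : G) (fun k => (w.2 k : G)) j m := by
  rw [Space.ext_iff]
  exact Germ.coe_eq

theorem point_mem_cylinder_of_le (hP : P.IsAdmissible) {j n : ℕ} (h : j ≤ n) (a : P.F n)
    (z : P.F j × (∀ k, P.C k)) :
    P.point j z ∈ P.cylinder n a ↔ path (z.1 : G) (fun k => (z.2 k : G)) j n = a := by
  constructor
  · rintro ⟨c, hc⟩
    rw [point_eq_iff] at hc
    obtain ⟨m, hm, hnm⟩ := (hc.and (eventually_ge_atTop n)).exists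
    rw [← path_path _ _ h hnm] at hm
    exact congrArg Subtype.val
      (path_unique hP hnm ⟨_, path_mem hP h z.1 z.2⟩ a z.2 c hm).1
  · intro e
    refine ⟨z.2, ?_⟩
    rw [point_eq_iff]
    filter_upwards [eventually_ge_atTop n] with m hm
    rw [← path_path _ _ h hm, e]

theorem point_mem_cylinder_of_ge (hP : P.IsAdmissible) {j n : ℕ} (h : n ≤ j) (a : P.F n)
    (z : P.F j × (∀ k, P.C k)) :
    P.point j z ∈ P.cylinder n a ↔
      ∃ c : ∀ k, P.C k, path (a : G) (fun k => (c k : G)) n j = z.1 := by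
  constructor
  · rintro ⟨c, hc⟩
    refine ⟨c, ?_⟩
    rw [eq_comm, point_eq_iff] at hc
    obtain ⟨m, hm, hjm⟩ := (hc.and (eventually_ge_atTop j)).exists
    rw [← path_path _ _ h hjm] at hm
    exact congrArg Subtype.val
      (path_unique hP hjm ⟨_, path_mem hP h a c⟩ z.1 c z.2 hm).1
  · rintro ⟨c, hc⟩
    refine ⟨fun k => if k < j then c k else z.2 k, ?_⟩
    rw [eq_comm, point_eq_iff]
    filter_upwards [eventually_ge_atTop j] with m hm
    rw [← path_path _ _ h hm]
    have h1 : path (a : G) (fun k => ((if k < j then c k else z.2 k : P.C k) : G)) n j = z.1 := by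
      rw [← hc]
      exact path_congr _ fun k _ hk => by rw [if_pos hk]
    rw [h1]
    exact path_congr _ fun k hk _ => by rw [if_neg (by omega)]

theorem path_not_new (hP : P.IsAdmissible) {n j : ℕ} (h : n < j) (a : P.F n) (c : ∀ k, P.C k)
    (f : P.F j) (hf : f ∈ P.newF j) : path (a : G) (fun k => (c k : G)) n j ≠ f := by
  intro e
  obtain ⟨j, rfl⟩ : ∃ i, j = i + 1 := ⟨j - 1, by omega⟩
  refine hf ?_
  rw [← e, path_succ _ _ (by omega)]
  exact Set.mul_mem_mul (path_mem hP (by omega) a c) (c j).2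

theorem exists_new (hP : P.IsAdmissible) (n : ℕ) (a : P.F n) :
    ∃ j, j ≤ n ∧ ∃ f ∈ P.newF j, ∃ d : ∀ k, P.C k,
      path (f : G) (fun k => (d k : G)) j n = a := by
  induction n with
  | zero => exact ⟨0, le_rfl, a, trivial, fun k => ⟨1, hP.one_mem_C k⟩, rfl⟩
  | succ n ih =>
    by_cases ha : a ∈ P.newF (n + 1)
    · exact ⟨n + 1, le_rfl, a, ha, fun k => ⟨1, hP.one_mem_C k⟩, path_of_le _ _ le_rfl⟩
    · obtain ⟨b, hb, c0, hc0, e⟩ : (a : G) ∈ P.F n * P.C n := not_not.1 ha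
      obtain ⟨j, hj, f, hf, d, hd⟩ := ih ⟨b, hb⟩
      refine ⟨j, by omega, f, hf, fun k => if hk : k = n then ⟨c0, hk ▸ hc0⟩ else d k, ?_⟩
      rw [path_succ _ _ hj, ← e]
      dsimp only
      rw [dif_pos rfl]
      congr 1
      rw [← show _ = b from hd]
      exact path_congr _ fun k _ hk => by rw [dif_neg (by omega)]

theorem ν_path (hP : P.IsAdmissible) {j n : ℕ} (h : j ≤ n) (f : P.F j) (d : ∀ k, P.C k) :
    P.ν n {path (f : G) (fun k => (d k : G)) j n} =
      P.ν j {(f : G)} * ∏ k ∈ Finset.Ico j n, P.κ k {(d k : G)} := by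
  induction n, h using Nat.le_induction with
  | base => simp [path_of_le]
  | succ n hn ih =>
    rw [path_succ _ _ hn, hP.ν_succ n _ (path_mem hP hn f d) _ (d n).2, ih,
      Finset.prod_Ico_succ_top hn, mul_assoc]

variable [DiscreteMeasurableSpace G]

theorem measurable_point [Countable G] (hP : P.IsAdmissible) (j : ℕ) :
    Measurable (P.point j) := by
  refine measurable_generateFrom ?_
  rintro _ ⟨n, a, rfl⟩
  rcases le_total j n with h | h
  · have : Measurable fun z : P.F j × (∀ k, P.C k) =>
        path (z.1 : G) (fun k => (z.2 k : G)) j n := by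
      clear a
      induction n, h using Nat.le_induction with
      | base =>
        simp only [path_of_le _ _ (le_refl j)]
        fun_prop
      | succ n hn ih =>
        simp only [path_succ _ _ hn]
        exact (Measurable.of_discrete (f := fun p : G × G => p.1 * p.2)).comp
          (ih.prodMk (by fun_prop))
    convert this (MeasurableSet.of_discrete (s := {(a : G)})) using 1
    ext z
    exact point_mem_cylinder_of_le hP h a z
  · have : P.point j ⁻¹' P.cylinder n a = Prod.fst ⁻¹'
        {f : P.F j | ∃ c : ∀ k, P.C k, path (a : G) (fun k => (c k : G)) n j = f} := by
      ext z
      exact point_mem_cylinder_of_ge hP h a z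
    rw [this]
    exact measurable_fst (MeasurableSet.of_discrete)

/-- The measure of `X` takes the value `ν n {a}` on the cylinder `[a]_n`. -/
theorem measure_cylinder [Countable G] (hP : P.IsAdmissible) (n : ℕ) (a : P.F n) :
    P.measure hP (P.cylinder n a) = P.ν n {(a : G)} := by
  have hκ := isProbabilityMeasure_κC hP
  have hν := hP.finite_ν
  have hνF : ∀ j, IsFiniteMeasure (P.νF j) := fun j =>
    ⟨by
      rw [νF, comap_subtype_coe_apply (MeasurableSet.of_discrete)]
      exact measure_lt_top _ _⟩
  have hmeas : MeasurableSet (P.cylinder n a) := MeasurableSpace.measurableSet_generateFrom ⟨n, a, rfl⟩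
  obtain ⟨j, hj, f, hf, d, hd⟩ := exists_new hP n a
  rw [measure, Measure.sum_apply _ hmeas, tsum_eq_single j]
  · rw [Measure.map_apply (measurable_point hP j) hmeas]
    have hset : P.point j ⁻¹' P.cylinder n a =
        {f} ×ˢ Set.pi (Finset.Ico j n : Set ℕ) (fun k => {d k}) := by
      ext z
      rw [Set.mem_preimage, point_mem_cylinder_of_le hP hj]
      simp only [Set.mem_prod, Set.mem_singleton_iff, Set.mem_pi, Finset.coe_Ico, Set.mem_Ico]
      constructor
      · intro e
        obtain ⟨h1, h2⟩ := path_unique hP hj z.1 f z.2 d (e.trans hd.symm)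
        exact ⟨h1, fun k hk => h2 k hk.1 hk.2⟩
      · rintro ⟨h1, h2⟩
        rw [← hd, h1]
        exact path_congr _ fun k h3 h4 => by rw [h2 k ⟨h3, h4⟩]
    rw [hset, Measure.prod_prod, Measure.infinitePi_pi _ (fun k _ => MeasurableSet.of_discrete),
      Measure.restrict_apply (MeasurableSet.of_discrete),
      Set.inter_eq_left.2 (Set.singleton_subset_iff.2 hf), ← hd, ν_path hP hj, νF,
      comap_subtype_coe_apply (MeasurableSet.of_discrete)]
    simp only [κC, comap_subtype_coe_apply (MeasurableSet.of_discrete), Set.image_singleton]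
  · intro i hi
    rw [Measure.map_apply (measurable_point hP i) hmeas]
    have hsub : P.point i ⁻¹' P.cylinder n a ⊆ (P.newF i)ᶜ ×ˢ Set.univ := by
      intro z hz
      refine ⟨fun hz1 => ?_, trivial⟩
      rcases lt_or_ge n i with h | h
      · obtain ⟨c, hc⟩ := (point_mem_cylinder_of_ge hP h.le a z).1 hz
        exact path_not_new hP h a c z.1 hz1 hc
      · have e := (point_mem_cylinder_of_le hP h a z).1 hz
        rcases lt_or_gt_of_ne hi with hlt | hlt
        · rw [← path_path _ _ hlt.le hj] at e
          have := (path_unique hP hj ⟨_, path_mem hP hlt.le z.1 z.2⟩ f z.2 d (e.trans hd.symm)).1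
          exact path_not_new hP hlt z.1 z.2 f hf (congrArg Subtype.val this)
        · rw [← path_path _ _ hlt.le h] at hd
          have := (path_unique hP h ⟨_, path_mem hP hlt.le f d⟩ z.1 d z.2 (hd.trans e.symm)).1
          exact path_not_new hP hlt f d z.1 hz1 (congrArg Subtype.val this)
    refine measure_mono_null hsub ?_
    rw [Measure.prod_prod, Measure.restrict_apply (MeasurableSet.of_discrete)]
    simp

end Cylinder

/-! ### Telescopings -/

/-- The `l`-telescoping of a sequence of `(C,F)`-parameters. -/
noncomputable def telescope (P : CFData G) (l : ℕ → ℕ) : CFData G where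
  C n := blockSet P.C (l n) (l (n + 1))
  F n := P.F (l n)
  κ n := blockConv P.κ (l n) (l (n + 1))
  ν n := P.ν (l n)

/-- The parameters are compatible with the sequence `(Γ n)` of subgroups, that is, with the base
point of the projective limit of the spaces `G ⧸ Γ n`. -/
def IsCompatible (P : CFData G) (Γ : ℕ → Subgroup G) : Prop :=
  ∑' n, P.κ n {c | c ∈ P.C n ∧ c ∉ Γ n} < ∞

end CFData

/-! ### Odometers -/

/-- A strictly decreasing sequence of subgroups of finite index such that the intersection of all
conjugates of all of them is trivial. -/
structure IsOdometerSequence {G : Type*} [Group G] (Γ : ℕ → Subgroup G) : Prop where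
  strictAnti : StrictAnti Γ
  finiteIndex : ∀ n, (Γ n).FiniteIndex
  iInter_conj : ⋂ (n : ℕ) (g : G), {x : G | ∃ γ ∈ Γ n, x = g * γ * g⁻¹} = {1}

/-- The space of the odometer: the projective limit of the homogeneous spaces `G ⧸ Γ n`, i.e. the
sequences `(g_n Γ_n)` of cosets with `g_{n+1} Γ_{n+1} ⊆ g_n Γ_n`. -/
@[ext]
structure OdometerSpace {G : Type*} [Group G] (Γ : ℕ → Subgroup G) where
  /-- the coset `coord n = g_n Γ_n` -/
  coord : ∀ n, G ⧸ Γ n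
  coherent : ∀ (n : ℕ) (g : G),
    coord (n + 1) = (g : G ⧸ Γ (n + 1)) → coord n = (g : G ⧸ Γ n)

namespace OdometerSpace

variable {G : Type*} [Group G]

/-- The Borel structure of the odometer, induced by the product of the discrete spaces `G ⧸ Γ n`. -/
instance [MeasurableSpace G] (Γ : ℕ → Subgroup G) : MeasurableSpace (OdometerSpace Γ) :=
  MeasurableSpace.comap coord MeasurableSpace.pi

/-- The action of `G` on the odometer by left translations of all coordinates. -/
instance (Γ : ℕ → Subgroup G) : MulAction G (OdometerSpace Γ) where
  smul g y := ⟨fun n => g • y.coord n, fun n h hy => by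
    have h1 : y.coord (n + 1) = ((g⁻¹ * h : G) : G ⧸ Γ (n + 1)) := by
      rw [eq_comm, ← inv_smul_eq_iff] at hy
      exact hy.symm
    have h2 := y.coherent n _ h1
    change g • y.coord n = _
    rw [h2]
    change ((g * (g⁻¹ * h) : G) : G ⧸ Γ n) = _
    rw [mul_inv_cancel_left]⟩
  one_smul y := OdometerSpace.ext (funext fun n => one_smul G (y.coord n))
  mul_smul g h y := OdometerSpace.ext (funext fun n => mul_smul g h (y.coord n))

end OdometerSpace

/-- `ν` makes the topological odometer associated with `Γ` a nonsingular odometer: `ν` is a nonzero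
`σ`-finite Borel measure that is quasi-invariant and ergodic under the action of `G`. -/
structure IsNonsingularOdometer {G : Type*} [Group G] [MeasurableSpace G] (Γ : ℕ → Subgroup G)
    (ν : Measure (OdometerSpace Γ)) : Prop where
  sigmaFinite : SigmaFinite ν
  ne_zero : ν ≠ 0
  quasiInvariant : ∀ g : G,
    Measure.QuasiMeasurePreserving (fun y : OdometerSpace Γ => g • y) ν ν
  ergodic : ∀ A : Set (OdometerSpace Γ), MeasurableSet A →
    (∀ g : G, (fun y : OdometerSpace Γ => g • y) ⁻¹' A =ᵐ[ν] A) → ν A = 0 ∨ ν Aᶜ = 0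

/-- The odometer `(OdometerSpace Γ, ν)` is a factor of the nonsingular `(C,F)`-action: it is the
image of the action under a nonsingular `G`-equivariant map, defined modulo null sets. -/
def CFData.HasFactor {G : Type*} [Group G] [MeasurableSpace G] [DiscreteMeasurableSpace G]
    (P : CFData G) (hP : P.IsAdmissible) (Γ : ℕ → Subgroup G)
    (ν : Measure (OdometerSpace Γ)) : Prop :=
  ∃ π : P.Space → OdometerSpace Γ, Measurable π ∧
    (∀ g : G, ∀ᵐ x ∂(P.measure hP), π (P.T g x) = g • π x) ∧
    (P.measure hP).map π ≪ ν ∧ ν ≪ (P.measure hP).map π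

/-- The nonsingular `(C,F)`-action is isomorphic to the odometer `(OdometerSpace Γ, ν)`: there is a
nonsingular `G`-equivariant map between them which is invertible modulo null sets. -/
def CFData.IsIsomorphicTo {G : Type*} [Group G] [MeasurableSpace G] [DiscreteMeasurableSpace G]
    (P : CFData G) (hP : P.IsAdmissible) (Γ : ℕ → Subgroup G)
    (ν : Measure (OdometerSpace Γ)) : Prop :=
  ∃ (π : P.Space → OdometerSpace Γ) (σ : OdometerSpace Γ → P.Space),
    Measurable π ∧ Measurable σ ∧
    (∀ᵐ x ∂(P.measure hP), σ (π x) = x) ∧ (∀ᵐ y ∂ν, π (σ y) = y) ∧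
    (∀ g : G, ∀ᵐ x ∂(P.measure hP), π (P.T g x) = g • π x) ∧
    (P.measure hP).map π ≪ ν ∧ ν ≪ (P.measure hP).map π

/-- Failure of the approximation condition (at the base point of the odometer): for some `n > 0`,
the sets `C_{n+1} ⋯ C_m`, in the usual indexing, cannot be approximated, with arbitrary precision
and for all large `m`, by sets of those `f ∈ F m` whose coset `f Γ_l` lies in a given set `D` of
cosets of some `Γ_l`. -/
def CFData.ApproximationFails {G : Type*} [Group G] [MeasurableSpace G]
    (P : CFData G) (Γ : ℕ → Subgroup G) : Prop :=
  ∃ n : ℕ, 0 < n ∧ ∃ ε : ℝ≥0∞, 0 < ε ∧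
    ∀ (l : ℕ) (D : Set (G ⧸ Γ l)) (M : ℕ), n < M → ∃ m, M < m ∧
      ε < P.ν m (symmDiff (blockSet P.C n m) {f | f ∈ P.F m ∧ (f : G ⧸ Γ l) ∈ D})

/-! The action multiplies the `F n`-coordinates on the left, and on each `X_n` the increments of the
coordinates beyond level `n` are independent, with the convolutions of the `κ k` as laws. The proof
reads these two facts modulo the subgroups `Γ l`.

From a compatible telescoping to a factor: by Borel–Cantelli, almost surely all but finitely many
increments from level `q n` to level `q (n + 1)` lie in `Γ n`, so the cosets of the coordinates
modulo each `Γ l` are eventually constant (`ae_stabilizes`). Their limit `limitMap` is equivariant,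
and the image measure inherits quasi-invariance and ergodicity from the action (`ergodic_T`).

From an equivariant map `π` to a compatible telescoping: the transformation by `f` carries the box
of `1` onto the box of `f`, so `π` misses `f • a` in the `l`-th coordinate on the box of `f` in the
same proportion, `defect`, as it misses `a` on the box of `1`. Borel sets are nearly unions of
boxes, so for large `n` some `a` has small defect. As `G ⧸ Γ l` is finite, these `a` have a limit
along an ultrafilter, which is a point `y` of the odometer (`exists_limit_point`). If `c` moves
`y.coord l`, then most of the box of `c`, inside the box of `1`, is deviating; so such `c` have mass
at most twice the defect (`blockConv_ne_le`). Levels with geometrically small defects give a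
telescoping compatible with the stabilizers of the coordinates of `y`. These are conjugates of the
`Γ n` and form an odometer sequence again.

Non-atomicity: the fibre over `y` can return to itself only under the stabilizer of `y`. If that is
finite, then at each level boundedly many boxes are more than half filled by the fibre, and single
boxes become negligible (`measure_eq_zero_of_finite`).

Isomorphism: if the approximation condition does not fail, the boxes of `1`, and by equivariance all
boxes, are preimages under `limitMap` modulo null sets, so `limitMap` is invertible. Conversely, an
isomorphism turns a box into a Borel set of the odometer, which is nearly determined by one
coordinate; replacing that coordinate by `f • y.coord l` on the box of `f` costs only the defect.
Finiteness of the measure makes both errors small on the whole space. -/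

namespace CFData

/-! ### Ordered products of the sets `C n` -/

section BlockSet

variable {G : Type*} [Group G]

theorem blockSet_self (C : ℕ → Set G) (n : ℕ) : blockSet C n n = 1 := by
  cases n with
  | zero => rfl
  | succ n => rw [blockSet, if_neg (by omega)]

theorem blockSet_succ (C : ℕ → Set G) {n m : ℕ} (h : n ≤ m) :
    blockSet C n (m + 1) = blockSet C n m * C m := by
  rw [blockSet, if_pos h]

theorem blockSet_mul_blockSet (C : ℕ → Set G) {n j m : ℕ} (h : n ≤ j) (h' : j ≤ m) :
    blockSet C n j * blockSet C j m = blockSet C n m := by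
  induction m, h' using Nat.le_induction with
  | base => rw [blockSet_self, mul_one]
  | succ m hm ih => rw [blockSet_succ _ hm, blockSet_succ _ (h.trans hm), ← mul_assoc, ih]

theorem blockSet_comp (C : ℕ → Set G) {q : ℕ → ℕ} (hq : Monotone q) {n m : ℕ} (h : n ≤ m) :
    blockSet (fun k => blockSet C (q k) (q (k + 1))) n m = blockSet C (q n) (q m) := by
  induction m, h using Nat.le_induction with
  | base => rw [blockSet_self, blockSet_self]
  | succ m hm ih =>
    rw [blockSet_succ _ hm, ih, blockSet_mul_blockSet _ (hq hm) (hq (Nat.le_succ m))]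

end BlockSet

/-! ### Boxes, levels and coordinates in the `(C,F)`-space -/

variable {G : Type*} [Group G] [MeasurableSpace G] {P : CFData G}

theorem IsAdmissible.one_mem_blockSet (hP : P.IsAdmissible) {n m : ℕ} (h : n ≤ m) :
    1 ∈ blockSet P.C n m := by
  induction m, h using Nat.le_induction with
  | base => rw [blockSet_self]; exact Set.one_mem_one
  | succ m hm ih =>
    rw [blockSet_succ _ hm, ← one_mul (1 : G)]
    exact Set.mul_mem_mul ih (hP.one_mem_C m)

theorem IsAdmissible.mul_blockSet_mem (hP : P.IsAdmissible) {n m : ℕ} (h : n ≤ m) {a b : G}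
    (ha : a ∈ P.F n) (hb : b ∈ blockSet P.C n m) : a * b ∈ P.F m := by
  induction m, h using Nat.le_induction generalizing b with
  | base =>
    rw [blockSet_self] at hb
    rwa [Set.mem_one.1 hb, mul_one]
  | succ m hm ih =>
    rw [blockSet_succ _ hm] at hb
    obtain ⟨b, hb, c, hc, rfl⟩ := hb
    rw [← mul_assoc]
    exact hP.mul_subset m (Set.mul_mem_mul (ih hb) hc)

theorem IsAdmissible.blockSet_subset (hP : P.IsAdmissible) {n m : ℕ} (h : n ≤ m) :
    blockSet P.C n m ⊆ P.F m := fun b hb => by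
  simpa using hP.mul_blockSet_mem h (hP.one_mem_F n) hb

/-- The cylinder `[a]_n`, for an arbitrary element `a` of the group; it is empty if `a ∉ F n`. -/
def box (P : CFData G) (n : ℕ) (a : G) : Set P.Space :=
  {x | ∃ h : a ∈ P.F n, x ∈ P.cylinder n ⟨a, h⟩}

theorem box_eq_cylinder {n : ℕ} (a : P.F n) : P.box n a = P.cylinder n a := by
  ext x
  exact ⟨fun ⟨_, h⟩ => h, fun h => ⟨a.2, h⟩⟩

theorem box_eq_empty {n : ℕ} {a : G} (h : a ∉ P.F n) : P.box n a = ∅ :=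
  Set.eq_empty_of_forall_notMem fun _ hx => h hx.1

theorem mem_F_of_mem_box {n : ℕ} {a : G} {x : P.Space} (h : x ∈ P.box n a) : a ∈ P.F n := h.1

theorem exists_eq_point (x : P.Space) : ∃ n z, x = P.point n z := by
  obtain ⟨g, n, f, c, rfl⟩ := x
  exact ⟨n, (f, c), rfl⟩

theorem point_mem_box (hP : P.IsAdmissible) {j n : ℕ} (h : j ≤ n) (a : G)
    (z : P.F j × (∀ k, P.C k)) :
    P.point j z ∈ P.box n a ↔ path (z.1 : G) (fun k => (z.2 k : G)) j n = a := by
  constructor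
  · rintro ⟨h1, h2⟩
    exact (point_mem_cylinder_of_le hP h _ _).1 h2
  · intro e
    have ha : a ∈ P.F n := e ▸ path_mem hP h z.1 z.2
    exact ⟨ha, (point_mem_cylinder_of_le hP h ⟨a, ha⟩ _).2 e⟩

theorem eq_of_mem_box (hP : P.IsAdmissible) {n : ℕ} {a b : G} {x : P.Space}
    (ha : x ∈ P.box n a) (hb : x ∈ P.box n b) : a = b := by
  obtain ⟨h, c, rfl⟩ := ha
  rw [point_mem_box hP le_rfl, path_of_le _ _ le_rfl] at hb
  exact hb

theorem exists_mem_box (hP : P.IsAdmissible) (x : P.Space) : ∃ n a, x ∈ P.box n a := by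
  obtain ⟨n, z, rfl⟩ := exists_eq_point x
  exact ⟨n, _, (point_mem_box hP le_rfl _ _).2 rfl⟩

theorem exists_mem_box_succ (hP : P.IsAdmissible) {n : ℕ} {a : G} {x : P.Space}
    (hx : x ∈ P.box n a) : ∃ c ∈ P.C n, x ∈ P.box (n + 1) (a * c) := by
  obtain ⟨h, c, rfl⟩ := hx
  refine ⟨c n, (c n).2, ?_⟩
  rw [point_mem_box hP (Nat.le_succ n), path_succ _ _ le_rfl, path_of_le _ _ le_rfl]

theorem box_succ_subset (hP : P.IsAdmissible) {n : ℕ} {a c : G} (ha : a ∈ P.F n)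
    (hc : c ∈ P.C n) : P.box (n + 1) (a * c) ⊆ P.box n a := by
  classical
  rintro x ⟨h, d, rfl⟩
  refine ⟨ha, (point_mem_cylinder_of_ge hP (Nat.le_succ n) _ _).2
    ⟨fun k => if hk : k = n then ⟨c, hk ▸ hc⟩ else d k, ?_⟩⟩
  rw [path_succ _ _ le_rfl, path_of_le _ _ le_rfl]
  simp

theorem exists_mem_box_of_le (hP : P.IsAdmissible) {n m : ℕ} (h : n ≤ m) {a : G} {x : P.Space}
    (hx : x ∈ P.box n a) : ∃ b ∈ blockSet P.C n m, x ∈ P.box m (a * b) := by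
  induction m, h using Nat.le_induction with
  | base => exact ⟨1, hP.one_mem_blockSet le_rfl, by rwa [mul_one]⟩
  | succ m hm ih =>
    obtain ⟨b, hb, hx⟩ := ih
    obtain ⟨c, hc, hx⟩ := exists_mem_box_succ hP hx
    refine ⟨b * c, ?_, by rwa [← mul_assoc]⟩
    rw [blockSet_succ _ hm]
    exact Set.mul_mem_mul hb hc

theorem box_mul_subset (hP : P.IsAdmissible) {n m : ℕ} (h : n ≤ m) {a b : G} (ha : a ∈ P.F n)
    (hb : b ∈ blockSet P.C n m) : P.box m (a * b) ⊆ P.box n a := by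
  induction m, h using Nat.le_induction generalizing b with
  | base =>
    rw [blockSet_self] at hb
    rw [Set.mem_one.1 hb, mul_one]
  | succ m hm ih =>
    rw [blockSet_succ _ hm] at hb
    obtain ⟨b, hb, c, hc, rfl⟩ := hb
    dsimp only
    rw [← mul_assoc]
    exact (box_succ_subset hP (hP.mul_blockSet_mem hm ha hb) hc).trans (ih hb)

theorem box_eq_iUnion (hP : P.IsAdmissible) {n m : ℕ} (h : n ≤ m) {a : G} (ha : a ∈ P.F n) :
    P.box n a = ⋃ b, ⋃ _ : b ∈ blockSet P.C n m, P.box m (a * b) := by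
  refine Set.Subset.antisymm (fun x hx => ?_) (Set.iUnion_subset fun b =>
    Set.iUnion_subset fun hb => box_mul_subset hP h ha hb)
  obtain ⟨b, hb, hx⟩ := exists_mem_box_of_le hP h hx
  exact Set.mem_iUnion₂.2 ⟨b, hb, hx⟩

/-- The part `X_n` of the `(C,F)`-space. -/
def level (P : CFData G) (n : ℕ) : Set P.Space := {x | ∃ a, x ∈ P.box n a}

theorem level_mono (hP : P.IsAdmissible) : Monotone P.level := fun n m h x ⟨a, ha⟩ => by
  obtain ⟨b, -, hb⟩ := exists_mem_box_of_le hP h ha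
  exact ⟨_, hb⟩

theorem iUnion_level (hP : P.IsAdmissible) : ⋃ n, P.level n = Set.univ :=
  Set.eq_univ_of_forall fun x => Set.mem_iUnion.2 (exists_mem_box hP x)

theorem eventually_mem_level (hP : P.IsAdmissible) (x : P.Space) :
    ∀ᶠ n in atTop, x ∈ P.level n := by
  obtain ⟨n, hn⟩ := exists_mem_box hP x
  filter_upwards [eventually_ge_atTop n] with m hm using level_mono hP hm hn

open Classical in
/-- The `F n`-coordinate of a point of `X_n`; it takes the value `1` outside `X_n`. -/
noncomputable def coord (P : CFData G) (n : ℕ) (x : P.Space) : G :=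
  if h : x ∈ P.level n then h.choose else 1

theorem mem_box_coord {n : ℕ} {x : P.Space} (h : x ∈ P.level n) : x ∈ P.box n (P.coord n x) := by
  rw [coord, dif_pos h]
  exact h.choose_spec

theorem coord_mem_F (hP : P.IsAdmissible) (n : ℕ) (x : P.Space) : P.coord n x ∈ P.F n := by
  by_cases h : x ∈ P.level n
  · exact mem_F_of_mem_box (mem_box_coord h)
  · rw [coord, dif_neg h]
    exact hP.one_mem_F n

theorem coord_eq (hP : P.IsAdmissible) {n : ℕ} {a : G} {x : P.Space} (h : x ∈ P.box n a) :
    P.coord n x = a := eq_of_mem_box hP (mem_box_coord ⟨a, h⟩) h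

theorem mem_box_iff (hP : P.IsAdmissible) {n : ℕ} {a : G} {x : P.Space} :
    x ∈ P.box n a ↔ x ∈ P.level n ∧ P.coord n x = a :=
  ⟨fun h => ⟨⟨a, h⟩, coord_eq hP h⟩, fun ⟨h, e⟩ => e ▸ mem_box_coord h⟩

theorem inv_coord_mul_coord_mem (hP : P.IsAdmissible) {n m : ℕ} (h : n ≤ m) {x : P.Space}
    (hx : x ∈ P.level n) : (P.coord n x)⁻¹ * P.coord m x ∈ blockSet P.C n m := by
  obtain ⟨b, hb, hxb⟩ := exists_mem_box_of_le hP h (mem_box_coord hx)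
  rw [coord_eq hP hxb]
  simpa using hb

theorem mem_box_iff_of_le (hP : P.IsAdmissible) {n m : ℕ} (h : n ≤ m) {a : G} (ha : a ∈ P.F n)
    {x : P.Space} : x ∈ P.box n a ↔
      x ∈ P.level m ∧ a⁻¹ * P.coord m x ∈ blockSet P.C n m := by
  constructor
  · intro hx
    refine ⟨level_mono hP h ⟨a, hx⟩, ?_⟩
    have := inv_coord_mul_coord_mem hP h ⟨a, hx⟩
    rwa [coord_eq hP hx] at this
  · rintro ⟨h1, h2⟩
    have := mem_box_coord h1
    rw [← mul_inv_cancel_left a (P.coord m x)] at this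
    exact box_mul_subset hP h ha h2 this

theorem level_eq_of_le (hP : P.IsAdmissible) {n m : ℕ} (h : n ≤ m) :
    P.level n = P.level m ∩ P.coord m ⁻¹' (P.F n * blockSet P.C n m) := by
  ext x
  constructor
  · intro hx
    refine ⟨level_mono hP h hx, P.coord n x, coord_mem_F hP n x, _,
      inv_coord_mul_coord_mem hP h hx, ?_⟩
    simp
  · rintro ⟨h1, a, ha, b, hb, hab⟩
    exact ⟨a, box_mul_subset hP h ha hb ((mem_box_iff hP).2 ⟨h1, hab.symm⟩)⟩

theorem germ_eq (hP : P.IsAdmissible) (x : P.Space) :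
    x.germ = ((fun n => P.coord n x : ℕ → G) : Germ atTop G) := by
  obtain ⟨n, z, rfl⟩ := exists_eq_point x
  refine Germ.coe_eq.2 ?_
  filter_upwards [eventually_ge_atTop n] with m hm
  exact (coord_eq hP ((point_mem_box hP hm _ _).2 rfl)).symm

/-- A sequence of group elements is eventually the sequence of coordinates of a point. -/
def IsEventualPath (P : CFData G) (s : ℕ → G) : Prop :=
  ∃ N, ∀ n, N ≤ n → s n ∈ P.F n ∧ (s n)⁻¹ * s (n + 1) ∈ P.C n

theorem IsEventualPath.isPoint (hP : P.IsAdmissible) {s : ℕ → G} (hs : P.IsEventualPath s) :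
    P.IsPoint (s : Germ atTop G) := by
  classical
  obtain ⟨N, hN⟩ := hs
  refine ⟨N, ⟨s N, (hN N le_rfl).1⟩,
    fun k => if hk : N ≤ k then ⟨_, (hN k hk).2⟩ else ⟨1, hP.one_mem_C k⟩, ?_⟩
  refine Germ.coe_eq.2 ?_
  filter_upwards [eventually_ge_atTop N] with m hm
  induction m, hm using Nat.le_induction with
  | base => rw [path_of_le _ _ le_rfl]
  | succ m hm ih =>
    rw [path_succ _ _ hm, ← ih]
    simp [hm]

theorem isEventualPath_of_isPoint (hP : P.IsAdmissible) {s : ℕ → G}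
    (hs : P.IsPoint (s : Germ atTop G)) : P.IsEventualPath s := by
  obtain ⟨n, f, c, h⟩ := hs
  obtain ⟨N, hN⟩ := eventually_atTop.1 (Germ.coe_eq.1 h)
  refine ⟨max n N, fun m hm => ?_⟩
  rw [hN m (by omega), hN (m + 1) (by omega), path_succ _ _ (by omega)]
  refine ⟨path_mem hP (by omega) f c, ?_⟩
  simp

/-- The representatives of the germ of a point are eventually its coordinates. -/
theorem exists_eventually_mem_box (hP : P.IsAdmissible) {s : ℕ → G} (x : P.Space)
    (hx : x.germ = (s : Germ atTop G)) : ∀ᶠ n in atTop, x ∈ P.box n (s n) := by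
  rw [germ_eq hP, Germ.coe_eq] at hx
  filter_upwards [hx, eventually_mem_level hP x] with n h1 h2
  rw [← h1]
  exact mem_box_coord h2

open Classical in
/-- The point with given coordinates, if there is one. -/
noncomputable def ofCoord (hP : P.IsAdmissible) (s : ℕ → G) : P.Space :=
  if h : P.IsEventualPath s then ⟨(s : Germ atTop G), h.isPoint hP⟩ else
    P.point 0 (⟨1, hP.one_mem_F 0⟩, fun k => ⟨1, hP.one_mem_C k⟩)

theorem isEventualPath_coord (hP : P.IsAdmissible) (x : P.Space) :
    P.IsEventualPath fun n => P.coord n x :=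
  isEventualPath_of_isPoint hP (germ_eq hP x ▸ x.isPoint)

theorem ofCoord_coord (hP : P.IsAdmissible) (x : P.Space) :
    P.ofCoord hP (fun n => P.coord n x) = x := by
  rw [ofCoord, dif_pos (isEventualPath_coord hP x)]
  exact Space.ext (germ_eq hP x).symm

/-- This form involves one term of `s` at a time, under countable operations, so measurability of
`ofCoord` in a parameter can be read off. -/
theorem ofCoord_mem_box_iff (hP : P.IsAdmissible) {s : ℕ → G} (hs : P.IsEventualPath s) {n : ℕ}
    {a : G} (ha : a ∈ P.F n) : P.ofCoord hP s ∈ P.box n a ↔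
      ∀ᶠ m in atTop, a⁻¹ * s m ∈ blockSet P.C n m := by
  have h1 := exists_eventually_mem_box hP (P.ofCoord hP s) (s := s) (by rw [ofCoord, dif_pos hs])
  constructor
  · intro h
    filter_upwards [h1, eventually_ge_atTop n] with m hm hnm
    rw [← coord_eq hP hm]
    exact ((mem_box_iff_of_le hP hnm ha).1 h).2
  · intro h
    obtain ⟨m, h2, h3, hnm⟩ := (h.and (h1.and (eventually_ge_atTop n))).exists
    rw [← coord_eq hP h3] at h2
    exact (mem_box_iff_of_le hP hnm ha).2 ⟨⟨_, h3⟩, h2⟩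

/-! ### The transformations -/

/-- The set on which `T g` is given by left multiplication of some coordinate. -/
def dom (P : CFData G) (g : G) : Set P.Space :=
  {x | ∃ n f, x ∈ P.box n f ∧ g * f ∈ P.F n}

theorem T_mem_box {n : ℕ} {f g : G} {x : P.Space} (hx : x ∈ P.box n f)
    (h : g * f ∈ P.F n) : P.T g x ∈ P.box n (g * f) := by
  obtain ⟨hf, c, rfl⟩ := hx
  rw [T_point P g n ⟨f, hf⟩ c h]
  exact ⟨h, c, rfl⟩

/-- If `g` times the coordinates were the germ of a point, these products would eventually lie in `F
n`, which puts `x` in `dom g`. So the default branch of `T` is taken off `dom g`. -/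
theorem T_eq_self_of_notMem_dom (hP : P.IsAdmissible) {g : G} {x : P.Space} (hx : x ∉ P.dom g) :
    P.T g x = x := by
  unfold T
  rw [dif_neg]
  intro h
  rw [germ_eq hP, Germ.map_coe] at h
  obtain ⟨N, hN⟩ := isEventualPath_of_isPoint hP h
  obtain ⟨n, hn, hNn⟩ := ((eventually_mem_level hP x).and (eventually_ge_atTop N)).exists
  exact hx ⟨n, _, mem_box_coord hn, (hN n hNn).1⟩

/-- Once left multiplication by `g` is possible at level `N`, it is possible at every later level,
since the increments are multiplied on the right. -/
theorem T_mem_box_iff (hP : P.IsAdmissible) {n N : ℕ} {a f g : G} {x : P.Space} (h : N ≤ n)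
    (hx : x ∈ P.box N f) (hg : g * f ∈ P.F N) : P.T g x ∈ P.box n a ↔ x ∈ P.box n (g⁻¹ * a) := by
  obtain ⟨b, hb, hxb⟩ := exists_mem_box_of_le hP h hx
  have h1 : g * (f * b) ∈ P.F n := by
    rw [← mul_assoc]
    exact hP.mul_blockSet_mem h hg hb
  have h2 := T_mem_box hxb h1
  constructor
  · intro h3
    rwa [← eq_of_mem_box hP h2 h3, inv_mul_cancel_left]
  · intro h3
    rwa [eq_of_mem_box hP hxb h3, mul_inv_cancel_left] at h2

theorem eventually_T_mem_box (hP : P.IsAdmissible) {g : G} {x : P.Space} (hx : x ∈ P.dom g) :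
    ∀ᶠ n in atTop, x ∈ P.box n (P.coord n x) ∧ g * P.coord n x ∈ P.F n ∧
      P.T g x ∈ P.box n (g * P.coord n x) := by
  obtain ⟨N, f, h1, h2⟩ := hx
  filter_upwards [eventually_ge_atTop N] with n hn
  obtain ⟨b, hb, hxb⟩ := exists_mem_box_of_le hP hn h1
  have h3 : g * (f * b) ∈ P.F n := by
    rw [← mul_assoc]
    exact hP.mul_blockSet_mem hn h2 hb
  rw [coord_eq hP hxb]
  exact ⟨hxb, h3, T_mem_box hxb h3⟩

theorem box_one_eq (hP : P.IsAdmissible) {n m : ℕ} (h : n ≤ m) :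
    P.box n 1 = P.level m ∩ P.coord m ⁻¹' blockSet P.C n m := by
  ext x
  rw [mem_box_iff_of_le hP h (hP.one_mem_F n)]
  simp

/-- The level from which `T g` acts on `x` may exceed `n`, so membership is compared at a late level
`m`: there `a` and `g⁻¹ * a` leave the same increment. -/
theorem mem_box_of_T_mem_box (hP : P.IsAdmissible) {g a : G} {n : ℕ} {x : P.Space}
    (hx : x ∈ P.dom g) (ha : g⁻¹ * a ∈ P.F n) (h : P.T g x ∈ P.box n a) :
    x ∈ P.box n (g⁻¹ * a) := by
  obtain ⟨m, ⟨h1, h2, h3⟩, hnm⟩ :=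
    ((eventually_T_mem_box hP hx).and (eventually_ge_atTop n)).exists
  rw [mem_box_iff_of_le hP hnm ha]
  have := ((mem_box_iff_of_le hP hnm (mem_F_of_mem_box h)).1 h).2
  rw [coord_eq hP h3] at this
  exact ⟨⟨_, h1⟩, by rwa [mul_inv_rev, inv_inv, mul_assoc]⟩

/-! ### Measurability -/

theorem measurableSet_box (n : ℕ) (a : G) : MeasurableSet (P.box n a) := by
  by_cases h : a ∈ P.F n
  · rw [box_eq_cylinder ⟨a, h⟩]
    exact MeasurableSpace.measurableSet_generateFrom ⟨n, _, rfl⟩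
  · rw [box_eq_empty h]
    exact MeasurableSet.empty

theorem generateFrom_box : (inferInstance : MeasurableSpace P.Space) =
    MeasurableSpace.generateFrom {A | ∃ n a, A = P.box n a} := by
  refine le_antisymm (MeasurableSpace.generateFrom_le ?_) (MeasurableSpace.generateFrom_le ?_)
  · rintro _ ⟨n, a, rfl⟩
    exact MeasurableSpace.measurableSet_generateFrom ⟨n, a, (box_eq_cylinder a).symm⟩
  · rintro _ ⟨n, a, rfl⟩
    exact measurableSet_box n a

theorem measurable_of_box {α : Type*} [MeasurableSpace α] {f : α → P.Space}
    (h : ∀ n a, MeasurableSet (f ⁻¹' P.box n a)) : Measurable f := by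
  refine measurable_generateFrom ?_
  rintro _ ⟨n, a, rfl⟩
  rw [← box_eq_cylinder]
  exact h n a

variable [Countable G]

theorem measurableSet_level (n : ℕ) : MeasurableSet (P.level n) := by
  have : P.level n = ⋃ a, P.box n a := by
    ext x
    simp [level]
  rw [this]
  exact MeasurableSet.iUnion fun a => measurableSet_box n a

theorem measurableSet_dom (g : G) : MeasurableSet (P.dom g) := by
  have : P.dom g = ⋃ n, ⋃ f, ⋃ _ : g * f ∈ P.F n, P.box n f := by
    ext x
    simp [dom, and_comm]
  rw [this]
  exact MeasurableSet.iUnion fun n => MeasurableSet.iUnion fun f => MeasurableSet.iUnion fun _ =>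
    measurableSet_box n f

theorem measurable_coord [DiscreteMeasurableSpace G] (hP : P.IsAdmissible) (n : ℕ) :
    Measurable (P.coord n) := by
  refine measurable_to_countable' fun a => ?_
  by_cases ha : a = 1
  · have : P.coord n ⁻¹' {a} = P.box n a ∪ (P.level n)ᶜ := by
      ext x
      by_cases hx : x ∈ P.level n
      · simp [mem_box_iff hP, hx]
      · simp [hx, coord, ha]
    rw [this]
    exact (measurableSet_box n a).union (measurableSet_level n).compl
  · have : P.coord n ⁻¹' {a} = P.box n a := by
      ext x
      by_cases hx : x ∈ P.level n
      · simp [mem_box_iff hP, hx]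
      · simp [mem_box_iff hP, hx, coord, Ne.symm ha]
    rw [this]
    exact measurableSet_box n a

open Classical in
theorem measurable_T (hP : P.IsAdmissible) (g : G) : Measurable (P.T g) := by
  refine measurable_of_box fun n a => ?_
  -- Split `dom g` into boxes of `f` at level `N` on which `T g` is translation by `g`. If `N ≤ n`,
  -- the preimage is a translated box; if `N > n`, the box of `g * f` lies inside the target or
  -- misses it.
  have : P.T g ⁻¹' P.box n a = (P.box n a \ P.dom g) ∪ ⋃ N, ⋃ f, ⋃ _ : g * f ∈ P.F N,
      if N ≤ n then P.box N f ∩ P.box n (g⁻¹ * a) else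
        if P.box N (g * f) ⊆ P.box n a then P.box N f else ∅ := by
    ext x
    simp only [Set.mem_preimage, Set.mem_union, Set.mem_sdiff, Set.mem_iUnion]
    constructor
    · intro h
      by_cases hx : x ∈ P.dom g
      · right
        obtain ⟨N, f, h1, h2⟩ := hx
        refine ⟨N, f, h2, ?_⟩
        split_ifs with h3 h4
        · exact ⟨h1, (T_mem_box_iff hP h3 h1 h2).1 h⟩
        · exact h1
        · refine h4 fun y hy => ?_
          have h5 := T_mem_box h1 h2
          have ha := mem_F_of_mem_box h
          have h6 := ((mem_box_iff_of_le hP (not_le.1 h3).le ha).1 h).2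
          rw [coord_eq hP h5] at h6
          rw [mem_box_iff_of_le hP (not_le.1 h3).le ha, coord_eq hP hy]
          exact ⟨⟨_, hy⟩, h6⟩
      · left
        rw [T_eq_self_of_notMem_dom hP hx] at h
        exact ⟨h, hx⟩
    · rintro (⟨h1, h2⟩ | ⟨N, f, h2, h⟩)
      · rwa [T_eq_self_of_notMem_dom hP h2]
      · split_ifs at h with h3 h4
        · exact (T_mem_box_iff hP h3 h.1 h2).2 h.2
        · exact h4 (T_mem_box h h2)
        · exact h.elim
  rw [this]
  refine ((measurableSet_box n a).diff (measurableSet_dom g)).union ?_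
  refine MeasurableSet.iUnion fun N => MeasurableSet.iUnion fun f => MeasurableSet.iUnion fun _ => ?_
  split_ifs
  · exact (measurableSet_box N f).inter (measurableSet_box _ _)
  · exact measurableSet_box N f
  · exact MeasurableSet.empty

end CFData

namespace CFData

variable {G : Type*} [Group G] [MeasurableSpace G] {P : CFData G}

/-! ### Convolutions of the `κ n` -/

section Conv

theorem blockConv_self (κ : ℕ → Measure G) (n : ℕ) : blockConv κ n n = Measure.dirac 1 := by
  cases n with
  | zero => rfl
  | succ n => rw [blockConv, if_neg (by omega)]

theorem blockConv_succ (κ : ℕ → Measure G) {n m : ℕ} (h : n ≤ m) :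
    blockConv κ n (m + 1) = (blockConv κ n m).mconv (κ m) := by
  rw [blockConv, if_pos h]

variable [DiscreteMeasurableSpace G] [Countable G]

theorem isProbabilityMeasure_blockConv (hP : P.IsAdmissible) {n m : ℕ} (h : n ≤ m) :
    IsProbabilityMeasure (blockConv P.κ n m) := by
  induction m, h using Nat.le_induction with
  | base => rw [blockConv_self]; infer_instance
  | succ m hm ih =>
    have := hP.prob_κ m
    rw [blockConv_succ _ hm, Measure.mconv]
    exact Measure.isProbabilityMeasure_map Measurable.of_discrete.aemeasurable

theorem blockConv_compl (hP : P.IsAdmissible) {n m : ℕ} (h : n ≤ m) :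
    blockConv P.κ n m (blockSet P.C n m)ᶜ = 0 := by
  induction m, h using Nat.le_induction with
  | base =>
    rw [blockConv_self, blockSet_self, Measure.dirac_apply' _ MeasurableSet.of_discrete]
    simp
  | succ m hm ih =>
    have := hP.prob_κ m
    have := isProbabilityMeasure_blockConv hP hm
    rw [blockConv_succ _ hm, blockSet_succ _ hm, Measure.mconv,
      Measure.map_apply Measurable.of_discrete MeasurableSet.of_discrete]
    have hsub : (fun x : G × G => x.1 * x.2) ⁻¹' (blockSet P.C n m * P.C m)ᶜ ⊆
        ((blockSet P.C n m)ᶜ ×ˢ Set.univ) ∪ (Set.univ ×ˢ (P.C m)ᶜ) := by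
      rintro ⟨x, y⟩ hxy
      by_contra hcon
      simp only [Set.mem_union, Set.mem_prod, Set.mem_compl_iff, Set.mem_univ, and_true, true_and,
        not_or, not_not] at hcon
      exact hxy (Set.mul_mem_mul hcon.1 hcon.2)
    refine measure_mono_null hsub (measure_union_null ?_ ?_)
    · rw [Measure.prod_prod, ih, zero_mul]
    · rw [Measure.prod_prod, hP.κ_compl, mul_zero]

/-- Factorizations are unique because block products lie in `F m`, so up to a null set the only pair
with product `b * c` is `(b, c)`. -/
theorem blockConv_succ_singleton (hP : P.IsAdmissible) {n m : ℕ} (h : n ≤ m) {b c : G}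
    (hb : b ∈ blockSet P.C n m) (hc : c ∈ P.C m) :
    blockConv P.κ n (m + 1) {b * c} = blockConv P.κ n m {b} * P.κ m {c} := by
  have := hP.prob_κ m
  have := isProbabilityMeasure_blockConv hP h
  rw [blockConv_succ _ h, Measure.mconv,
    Measure.map_apply Measurable.of_discrete MeasurableSet.of_discrete, ← Measure.prod_prod]
  have hnull : ((blockConv P.κ n m).prod (P.κ m)) (blockSet P.C n m ×ˢ P.C m)ᶜ = 0 := by
    rw [Set.compl_prod_eq_union]
    refine measure_union_null ?_ ?_
    · rw [Measure.prod_prod, blockConv_compl hP h, zero_mul]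
    · rw [Measure.prod_prod, hP.κ_compl, mul_zero]
  refine measure_congr ?_
  filter_upwards [measure_eq_zero_iff_ae_notMem.1 hnull] with x hx
  rw [Set.notMem_compl_iff] at hx
  refine propext ⟨fun hxb => ?_, ?_⟩
  · have := mul_unique hP (hP.blockSet_subset h hx.1) (hP.blockSet_subset h hb) hx.2 hc hxb
    exact ⟨this.1, this.2⟩
  · rintro ⟨rfl, rfl⟩
    rfl

theorem ν_mul_blockSet (hP : P.IsAdmissible) {n m : ℕ} (h : n ≤ m) {a b : G}
    (ha : a ∈ P.F n) (hb : b ∈ blockSet P.C n m) :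
    P.ν m {a * b} = P.ν n {a} * blockConv P.κ n m {b} := by
  induction m, h using Nat.le_induction generalizing b with
  | base =>
    rw [blockSet_self, Set.mem_one] at hb
    rw [hb, blockConv_self, mul_one]
    simp
  | succ m hm ih =>
    rw [blockSet_succ _ hm] at hb
    obtain ⟨b, hb, c, hc, rfl⟩ := hb
    dsimp only
    rw [← mul_assoc, hP.ν_succ m _ (hP.mul_blockSet_mem hm ha hb) _ hc, ih hb,
      blockConv_succ_singleton hP hm hb hc, mul_assoc]

end Conv

/-- Each factor is nonzero, as `1` is charged, and at most `1`; so the initial product can be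
divided out. -/
theorem tendsto_prod_Ico (hP : P.IsAdmissible) (n : ℕ) :
    Tendsto (fun m => ∏ k ∈ Finset.Ico n m, ⨆ c ∈ P.C k, P.κ k {c}) atTop (𝓝 0) := by
  set r : ℕ → ℝ≥0∞ := fun k => ⨆ c ∈ P.C k, P.κ k {c}
  have hr0 : ∀ k, r k ≠ 0 := fun k h => hP.κ_pos k 1 (hP.one_mem_C k) (le_antisymm
    (h ▸ le_iSup₂ (f := fun c (_ : c ∈ P.C k) => P.κ k {c}) 1 (hP.one_mem_C k)) zero_le)
  have hr1 : ∀ k, r k ≠ ∞ := fun k => ne_top_of_le_ne_top ENNReal.one_ne_top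
    (iSup₂_le fun c _ => by
      have := hP.prob_κ k
      exact prob_le_one)
  have hp0 : ∏ k ∈ Finset.range n, r k ≠ 0 := Finset.prod_ne_zero_iff.2 fun k _ => hr0 k
  have hp1 : ∏ k ∈ Finset.range n, r k ≠ ∞ := ENNReal.prod_ne_top fun k _ => hr1 k
  have h1 := ENNReal.Tendsto.const_mul (a := (∏ k ∈ Finset.range n, r k)⁻¹) hP.nonatomic
    (Or.inr (ENNReal.inv_ne_top.2 hp0))
  rw [mul_zero] at h1
  refine h1.congr' ?_
  filter_upwards [eventually_ge_atTop n] with m hm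
  rw [← Finset.prod_range_mul_prod_Ico _ hm, ← mul_assoc, ENNReal.inv_mul_cancel hp0 hp1, one_mul]

/-- Boxes are nested or disjoint, hence form a π-system after the empty set is ignored, and those of
level at least `N` already generate. The freedom in `N` serves comparisons that make sense only from
some level on. -/
theorem ext_of_box [Countable G] (hP : P.IsAdmissible) (N : ℕ) {μ₁ μ₂ : Measure P.Space}
    (hfin : ∀ n a, μ₁ (P.box n a) ≠ ∞)
    (h : ∀ n, N ≤ n → ∀ a, μ₁ (P.box n a) = μ₂ (P.box n a)) : μ₁ = μ₂ := by
  have hgen : (inferInstance : MeasurableSpace P.Space) =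
      MeasurableSpace.generateFrom {A | ∃ n, N ≤ n ∧ ∃ a, A = P.box n a} := by
    refine le_antisymm ?_ (MeasurableSpace.generateFrom_le ?_)
    · rw [generateFrom_box]
      refine MeasurableSpace.generateFrom_le ?_
      rintro _ ⟨n, a, rfl⟩
      by_cases ha : a ∈ P.F n
      · have hn : n ≤ max n N := le_max_left _ _
        rw [box_eq_iUnion hP hn ha]
        refine @MeasurableSet.iUnion _ _ (MeasurableSpace.generateFrom _) _ _ fun b =>
          @MeasurableSet.iUnion _ _ (MeasurableSpace.generateFrom _) _ _ fun hb =>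
          MeasurableSpace.measurableSet_generateFrom ⟨_, le_max_right _ _, _, rfl⟩
      · rw [box_eq_empty ha]
        exact @MeasurableSet.empty _ (MeasurableSpace.generateFrom _)
    · rintro _ ⟨n, -, a, rfl⟩
      exact measurableSet_box n a
  have key : ∀ n m a b, n ≤ m → (P.box n a ∩ P.box m b).Nonempty →
      P.box n a ∩ P.box m b = P.box m b := by
    rintro n m a b hnm ⟨x, hx, hx'⟩
    refine Set.inter_eq_right.2 fun y hy => ?_
    have ha := mem_F_of_mem_box hx
    rw [mem_box_iff_of_le hP hnm ha, coord_eq hP hx'] at hx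
    rw [mem_box_iff_of_le hP hnm ha, coord_eq hP hy]
    exact ⟨⟨_, hy⟩, hx.2⟩
  refine Measure.ext_of_generateFrom_of_cover_subset
    (T := Set.range fun p : {n // N ≤ n} × G => P.box p.1 p.2) hgen ?_ ?_
    (Set.countable_range _) ?_ ?_ ?_
  · rintro _ ⟨n, hn, a, rfl⟩ _ ⟨m, hm, b, rfl⟩ hne
    rcases le_total n m with h1 | h1
    · rw [key n m a b h1 hne]
      exact ⟨m, hm, b, rfl⟩
    · rw [Set.inter_comm] at hne ⊢
      rw [key m n b a h1 hne]
      exact ⟨n, hn, a, rfl⟩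
  · rintro _ ⟨⟨n, a⟩, rfl⟩
    exact ⟨n, n.2, a, rfl⟩
  · refine Set.eq_univ_of_forall fun x => ?_
    obtain ⟨n, ⟨a, hn⟩, hN⟩ := ((eventually_mem_level hP x).and (eventually_ge_atTop N)).exists
    exact ⟨_, ⟨(⟨n, hN⟩, a), rfl⟩, hn⟩
  · rintro _ ⟨⟨n, a⟩, rfl⟩
    exact hfin n a
  · rintro _ ⟨n, hn, a, rfl⟩
    exact h n hn a

/-! ### Values of the measure on boxes and laws of the coordinates -/

theorem ν_eq_zero (hP : P.IsAdmissible) {n : ℕ} {a : G} (h : a ∉ P.F n) : P.ν n {a} = 0 :=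
  measure_mono_null (Set.singleton_subset_iff.2 h) (hP.ν_compl n)

theorem ν_ne_top (hP : P.IsAdmissible) (n : ℕ) (s : Set G) : P.ν n s ≠ ∞ :=
  have := hP.finite_ν n
  measure_ne_top _ _

variable [DiscreteMeasurableSpace G]

theorem measure_box_eq_sum (hP : P.IsAdmissible) {n : ℕ} {f : G} (hf : f ∈ P.F n)
    (A : Set P.Space) (hA : MeasurableSet A) :
    P.measure hP (P.box n f ∩ A) =
      ∑ c ∈ (hP.finite_C n).toFinset, P.measure hP (P.box (n + 1) (f * c) ∩ A) := by
  rw [← measure_biUnion_finset]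
  · congr 1
    ext x
    simp only [Set.Finite.mem_toFinset, Set.mem_iUnion, exists_prop]
    constructor
    · rintro ⟨h1, h2⟩
      obtain ⟨c, hc, hx⟩ := exists_mem_box_succ hP h1
      exact ⟨c, hc, hx, h2⟩
    · rintro ⟨c, hc, hx, h2⟩
      exact ⟨box_succ_subset hP hf hc hx, h2⟩
  · intro c _ d _ hcd
    refine Set.disjoint_left.2 fun x hx hx' => hcd ?_
    exact mul_left_cancel (eq_of_mem_box hP hx.1 hx'.1)
  · exact fun c _ => (measurableSet_box _ _).inter hA

variable [Countable G]

theorem measure_box (hP : P.IsAdmissible) (n : ℕ) (a : G) :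
    P.measure hP (P.box n a) = P.ν n {a} := by
  by_cases h : a ∈ P.F n
  · rw [box_eq_cylinder ⟨a, h⟩, measure_cylinder]
  · rw [box_eq_empty h, ν_eq_zero hP h, measure_empty]

theorem measure_box_ne_top (hP : P.IsAdmissible) (n : ℕ) (a : G) :
    P.measure hP (P.box n a) ≠ ∞ := by
  rw [measure_box]
  exact ν_ne_top hP n _

/-- The image of the measure on `X_n` under the `F n`-coordinate. -/
theorem map_coord (hP : P.IsAdmissible) (n : ℕ) :
    ((P.measure hP).restrict (P.level n)).map (P.coord n) = P.ν n := by
  refine Measure.ext_of_singleton fun a => ?_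
  rw [Measure.map_apply (measurable_coord hP n) MeasurableSet.of_discrete,
    Measure.restrict_apply (measurable_coord hP n MeasurableSet.of_discrete), ← measure_box hP]
  congr 1
  ext x
  rw [mem_box_iff hP]
  exact and_comm

theorem measure_coord (hP : P.IsAdmissible) (n : ℕ) (S : Set G) :
    P.measure hP (P.level n ∩ P.coord n ⁻¹' S) = P.ν n S := by
  rw [← map_coord hP, Measure.map_apply (measurable_coord hP n) MeasurableSet.of_discrete,
    Measure.restrict_apply (measurable_coord hP n MeasurableSet.of_discrete), Set.inter_comm]

theorem measure_level (hP : P.IsAdmissible) (n : ℕ) : P.measure hP (P.level n) = P.ν n (P.F n) := by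
  rw [← measure_coord hP]
  congr 1
  ext x
  simp [coord_mem_F hP]

theorem measure_level_ne_top (hP : P.IsAdmissible) (n : ℕ) : P.measure hP (P.level n) ≠ ∞ := by
  rw [measure_level]
  exact ν_ne_top hP n _

instance sigmaFinite_measure (hP : P.IsAdmissible) : SigmaFinite (P.measure hP) :=
  ⟨⟨⟨P.level, fun _ => trivial, fun n => (measure_level_ne_top hP n).lt_top, iUnion_level hP⟩⟩⟩

theorem isFiniteMeasure_restrict_level (hP : P.IsAdmissible) (n : ℕ) :
    IsFiniteMeasure ((P.measure hP).restrict (P.level n)) :=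
  isFiniteMeasure_restrict.2 (measure_level_ne_top hP n)

/-- The joint distribution of the `F n`-coordinate and of the increment of the coordinates between
`n` and `m`. -/
theorem map_coord_prod (hP : P.IsAdmissible) {n m : ℕ} (h : n ≤ m) :
    ((P.measure hP).restrict (P.level n)).map
      (fun x => (P.coord n x, (P.coord n x)⁻¹ * P.coord m x)) =
      (P.ν n).prod (blockConv P.κ n m) := by
  have := hP.finite_ν n
  have := isProbabilityMeasure_blockConv hP h
  have hm : Measurable fun x => (P.coord n x, (P.coord n x)⁻¹ * P.coord m x) :=
    (measurable_coord hP n).prodMk ((Measurable.of_discrete (f := fun p : G × G => p.1⁻¹ * p.2)).comp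
      ((measurable_coord hP n).prodMk (measurable_coord hP m)))
  refine Measure.ext_of_singleton fun ⟨a, b⟩ => ?_
  rw [Measure.map_apply hm MeasurableSet.of_discrete,
    Measure.restrict_apply (hm MeasurableSet.of_discrete), ← Set.singleton_prod_singleton,
    Measure.prod_prod]
  by_cases ha : a ∈ P.F n
  · by_cases hb : b ∈ blockSet P.C n m
    · rw [← ν_mul_blockSet hP h ha hb, ← measure_box hP]
      congr 1
      ext x
      constructor
      · rintro ⟨⟨h1, h2⟩, h3⟩
        refine (mem_box_iff hP).2 ⟨level_mono hP h h3, ?_⟩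
        rw [← show _ = b from h2, ← show _ = a from h1]
        simp
      · intro hx
        have h1 := box_mul_subset hP h ha hb hx
        refine ⟨⟨coord_eq hP h1, ?_⟩, a, h1⟩
        change (P.coord n x)⁻¹ * P.coord m x = b
        rw [coord_eq hP h1, coord_eq hP hx, inv_mul_cancel_left]
    · rw [measure_mono_null (Set.singleton_subset_iff.2 hb) (blockConv_compl hP h), mul_zero]
      convert measure_empty (μ := P.measure hP)
      refine Set.eq_empty_of_forall_notMem ?_
      rintro x ⟨⟨h1, h2⟩, h3⟩
      apply hb
      rw [← show _ = b from h2]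
      exact inv_coord_mul_coord_mem hP h h3
  · rw [ν_eq_zero hP ha, zero_mul]
    convert measure_empty (μ := P.measure hP)
    refine Set.eq_empty_of_forall_notMem ?_
    rintro x ⟨⟨h1, h2⟩, h3⟩
    exact ha (h1 ▸ coord_mem_F hP n x)

theorem measure_coord_prod (hP : P.IsAdmissible) {n m : ℕ} (h : n ≤ m) (S B : Set G) :
    P.measure hP (P.level n ∩ {x | P.coord n x ∈ S ∧ (P.coord n x)⁻¹ * P.coord m x ∈ B}) =
      P.ν n S * blockConv P.κ n m B := by
  have := hP.finite_ν n
  have := isProbabilityMeasure_blockConv hP h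
  have hm : Measurable fun x => (P.coord n x, (P.coord n x)⁻¹ * P.coord m x) :=
    (measurable_coord hP n).prodMk ((Measurable.of_discrete (f := fun p : G × G => p.1⁻¹ * p.2)).comp
      ((measurable_coord hP n).prodMk (measurable_coord hP m)))
  rw [← Measure.prod_prod, ← map_coord_prod hP h, Measure.map_apply hm MeasurableSet.of_discrete,
    Measure.restrict_apply (hm MeasurableSet.of_discrete), Set.inter_comm]
  rfl

/-- `T g` maps the box of `f` onto the box of `g * f` and multiplies the measure by a constant. -/
theorem measure_box_inter_T_preimage (hP : P.IsAdmissible) {n : ℕ} {g f : G} (hf : f ∈ P.F n)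
    (hg : g * f ∈ P.F n) {A : Set P.Space} (hA : MeasurableSet A) :
    P.ν n {g * f} * P.measure hP (P.box n f ∩ P.T g ⁻¹' A) =
      P.ν n {f} * P.measure hP (P.box n (g * f) ∩ A) := by
  -- Both sides are measures, so they need comparing only on boxes of level `k ≥ n`. There `T g` is
  -- a translation, and both sides contain the same factor `blockConv P.κ n k`, evaluated at the
  -- increment `(g * f)⁻¹ * a`.
  have key : P.ν n {g * f} • ((P.measure hP).restrict (P.box n f)).map (P.T g) =
      P.ν n {f} • (P.measure hP).restrict (P.box n (g * f)) := by
    have happ : ∀ k a, (P.ν n {g * f} • ((P.measure hP).restrict (P.box n f)).map (P.T g))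
        (P.box k a) = P.ν n {g * f} * P.measure hP (P.box n f ∩ P.T g ⁻¹' P.box k a) := by
      intro k a
      rw [Measure.smul_apply, Measure.map_apply (measurable_T hP g) (measurableSet_box k a),
        Measure.restrict_apply (measurable_T hP g (measurableSet_box k a)), Set.inter_comm,
        smul_eq_mul]
    refine ext_of_box hP n (fun k a => ?_) (fun k hk a => ?_)
    · rw [happ]
      exact ENNReal.mul_ne_top (ν_ne_top hP n _)
        (measure_ne_top_of_subset Set.inter_subset_left (measure_box_ne_top hP n f))
    · rw [happ, Measure.smul_apply, Measure.restrict_apply (measurableSet_box k a), smul_eq_mul,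
        Set.inter_comm (P.box k a)]
      have h1 : P.box n f ∩ P.T g ⁻¹' P.box k a = P.box n f ∩ P.box k (g⁻¹ * a) := by
        ext x
        exact and_congr_right fun hx => T_mem_box_iff hP hk hx hg
      rw [h1]
      by_cases hb : (g * f)⁻¹ * a ∈ blockSet P.C n k
      · have e1 : g⁻¹ * a = f * ((g * f)⁻¹ * a) := by group
        have e2 : a = g * f * ((g * f)⁻¹ * a) := by group
        rw [e1, Set.inter_eq_right.2 (box_mul_subset hP hk hf hb)]
        conv_rhs => rw [e2]
        rw [Set.inter_eq_right.2 (box_mul_subset hP hk hg hb), measure_box, measure_box,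
          ν_mul_blockSet hP hk hf hb, ν_mul_blockSet hP hk hg hb]
        ring
      · have h2 : P.box n f ∩ P.box k (g⁻¹ * a) = ∅ := by
          refine Set.eq_empty_of_forall_notMem fun x hx => hb ?_
          have := ((mem_box_iff_of_le hP hk hf).1 hx.1).2
          rw [coord_eq hP hx.2] at this
          rwa [mul_inv_rev, mul_assoc]
        have h3 : P.box n (g * f) ∩ P.box k a = ∅ := by
          refine Set.eq_empty_of_forall_notMem fun x hx => hb ?_
          have := ((mem_box_iff_of_le hP hk hg).1 hx.1).2
          rwa [coord_eq hP hx.2] at this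
        rw [h2, h3, measure_empty, mul_zero, mul_zero]
  have := congrArg (fun m : Measure P.Space => m A) key
  simp only [Measure.smul_apply, smul_eq_mul] at this
  rwa [Measure.map_apply (measurable_T hP g) hA, Measure.restrict_apply (measurable_T hP g hA),
    Measure.restrict_apply hA, Set.inter_comm, Set.inter_comm A] at this

/-! ### Nonsingularity and ergodicity of the action -/

theorem measure_compl_dom (hP : P.IsAdmissible) (g : G) : P.measure hP (P.dom g)ᶜ = 0 := by
  have key : ∀ n, P.measure hP ((P.dom g)ᶜ ∩ P.level n) = 0 := by
    intro n
    -- Inside `X_n`, the complement of `dom g` misses all points whose `F m`-coordinate stays in `F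
    -- m` under `g`. By `conull` these exhaust the measure of `X_n` as `m` grows.
    have hle : ∀ m, n ≤ m → P.measure hP ((P.dom g)ᶜ ∩ P.level n) +
        P.ν m ((P.F n * blockSet P.C n m) ∩ {x | g * x ∈ P.F m}) ≤ P.ν n (P.F n) := by
      intro m hm
      rw [← measure_coord hP, ← measure_level hP, ← measure_union]
      · refine measure_mono (Set.union_subset Set.inter_subset_right ?_)
        rintro x ⟨h1, ⟨a, ha, b, hb, hab⟩, h2⟩
        refine ⟨a, box_mul_subset hP hm ha hb ((mem_box_iff hP).2 ⟨h1, hab.symm⟩)⟩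
      · rw [Set.disjoint_left]
        rintro x ⟨h1, h2⟩ ⟨h3, h4, h5⟩
        exact h1 ⟨m, _, mem_box_coord h3, h5⟩
      · exact (measurableSet_level m).inter (measurable_coord hP m MeasurableSet.of_discrete)
    have hlim := (hP.conull g n).const_add (P.measure hP ((P.dom g)ᶜ ∩ P.level n))
    have := le_of_tendsto hlim (eventually_atTop.2 ⟨n, hle⟩)
    by_contra hne
    exact absurd this (not_le.2 (by
      rw [add_comm]
      exact ENNReal.lt_add_right (ν_ne_top hP n _) hne))
  refine measure_mono_null (t := ⋃ n, (P.dom g)ᶜ ∩ P.level n) ?_ (measure_iUnion_null key)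
  rw [← Set.inter_iUnion, iUnion_level hP, Set.inter_univ]

theorem ae_mem_dom (hP : P.IsAdmissible) (g : G) : ∀ᵐ x ∂P.measure hP, x ∈ P.dom g := by
  have := measure_eq_zero_iff_ae_notMem.1 (measure_compl_dom hP g)
  simpa using this

/-- Almost all of the space is covered by countably many boxes on which `T g` is a translation that
scales the measure by a nonzero constant. -/
theorem measure_T_preimage_eq_zero (hP : P.IsAdmissible) (g : G) {A : Set P.Space}
    (hA : MeasurableSet A) (h0 : P.measure hP A = 0) : P.measure hP (P.T g ⁻¹' A) = 0 := by
  have hsub : P.T g ⁻¹' A ⊆ (P.dom g)ᶜ ∪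
      ⋃ n, ⋃ f, ⋃ _ : f ∈ P.F n ∧ g * f ∈ P.F n, P.box n f ∩ P.T g ⁻¹' A := by
    intro x hx
    by_cases hd : x ∈ P.dom g
    · right
      obtain ⟨n, f, h1, h2⟩ := hd
      exact Set.mem_iUnion.2 ⟨n, Set.mem_iUnion₂.2 ⟨f, ⟨mem_F_of_mem_box h1, h2⟩, h1, hx⟩⟩
    · exact Or.inl hd
  refine measure_mono_null hsub (measure_union_null (measure_compl_dom hP g)
    (measure_iUnion_null fun n => measure_iUnion_null fun f => measure_iUnion_null fun hf => ?_))
  have := measure_box_inter_T_preimage hP hf.1 hf.2 hA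
  rw [measure_mono_null Set.inter_subset_right h0, mul_zero] at this
  exact (mul_eq_zero.1 this).resolve_left (hP.ν_pos n _ hf.2)

theorem quasiMeasurePreserving_T (hP : P.IsAdmissible) (g : G) :
    Measure.QuasiMeasurePreserving (P.T g) (P.measure hP) (P.measure hP) := by
  refine ⟨measurable_T hP g, Measure.AbsolutelyContinuous.mk fun A hA h0 => ?_⟩
  rw [Measure.map_apply (measurable_T hP g) hA]
  exact measure_T_preimage_eq_zero hP g hA h0

/-- Translating from the box of `1` shows that an invariant set `A` fills the same proportion of
every box of a given level; splitting the box of `1` shows that the proportion `r` is the same at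
all levels. Hence the measure restricted to `A` is `r` times the measure, and evaluating at `Aᶜ` and
at `A` gives the alternative. -/
theorem ergodic_T (hP : P.IsAdmissible) {A : Set P.Space} (hA : MeasurableSet A)
    (hinv : ∀ g, P.T g ⁻¹' A =ᵐ[P.measure hP] A) :
    P.measure hP A = 0 ∨ P.measure hP Aᶜ = 0 := by
  set μ := P.measure hP with hμ
  have h1 : ∀ n, ∀ f ∈ P.F n, μ (P.box n f ∩ A) * P.ν n {1} = P.ν n {f} * μ (P.box n 1 ∩ A) := by
    intro n f hf
    have := measure_box_inter_T_preimage hP (hP.one_mem_F n) (g := f) (by simpa using hf) hA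
    rw [mul_one] at this
    rw [← measure_congr ((ae_eq_refl (P.box n 1)).inter (hinv f))]
    have h2 : P.measure hP (P.box n 1 ∩ P.T f ⁻¹' A) = μ (P.box n 1 ∩ A) :=
      measure_congr ((ae_eq_refl (P.box n 1)).inter (hinv f))
    rw [h2] at this ⊢
    rw [this, mul_comm]
  have hpos : ∀ n, P.ν n {1} ≠ 0 := fun n => hP.ν_pos n _ (hP.one_mem_F n)
  have hstep : ∀ n, ∀ f ∈ P.F n, μ (P.box n f ∩ A) =
      P.ν n {f} * (μ (P.box n 1 ∩ A) / P.ν n {1}) := by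
    intro n f hf
    rw [← mul_div_assoc, ENNReal.eq_div_iff (hpos n) (ν_ne_top hP n _), mul_comm, h1 n f hf]
  have hconst : ∀ n, μ (P.box n 1 ∩ A) / P.ν n {1} = μ (P.box 0 1 ∩ A) / P.ν 0 {1} := by
    intro n
    induction n with
    | zero => rfl
    | succ n ih =>
      rw [← ih]
      have e := measure_box_eq_sum hP (hP.one_mem_F n) A hA
      have e' := measure_box_eq_sum hP (hP.one_mem_F n) Set.univ MeasurableSet.univ
      simp only [Set.inter_univ, measure_box] at e'
      rw [ENNReal.eq_div_iff (hpos n) (ν_ne_top hP n _), e', Finset.sum_mul]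
      change _ = P.measure hP _
      rw [e]
      refine Finset.sum_congr rfl fun c hc => ?_
      rw [Set.Finite.mem_toFinset] at hc
      exact (hstep (n + 1) _ (hP.mul_subset n (Set.mul_mem_mul (hP.one_mem_F n) hc))).symm
  set r := μ (P.box 0 1 ∩ A) / P.ν 0 {1}
  have hrestr : μ.restrict A = r • μ := by
    refine ext_of_box hP 0 (fun n a => ?_) (fun n _ a => ?_)
    · rw [Measure.restrict_apply (measurableSet_box n a)]
      exact measure_ne_top_of_subset Set.inter_subset_left (measure_box_ne_top hP n a)
    · rw [Measure.restrict_apply (measurableSet_box n a), Measure.smul_apply, smul_eq_mul]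
      by_cases ha : a ∈ P.F n
      · rw [hstep n a ha, hconst n, hμ, measure_box, mul_comm]
      · rw [box_eq_empty ha]
        simp
  have h2 := congrArg (fun m : Measure P.Space => m Aᶜ) hrestr
  have h3 := congrArg (fun m : Measure P.Space => m A) hrestr
  simp only [Measure.smul_apply, smul_eq_mul, Measure.restrict_apply hA.compl,
    Set.compl_inter_self, measure_empty, Measure.restrict_apply hA, Set.inter_self] at h2 h3
  rcases mul_eq_zero.1 h2.symm with h | h
  · left
    rw [h3, h, zero_mul]
  · exact Or.inr h

theorem measure_ne_zero (hP : P.IsAdmissible) : P.measure hP ≠ 0 := by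
  intro h
  have := measure_box hP 0 1
  rw [h] at this
  exact hP.ν_pos 0 1 (hP.one_mem_F 0) this.symm

/-- On `X_n`, every measurable set is approximated by sets that depend only on the coordinate
in `F m`, when `m` is large. -/
theorem exists_approx (hP : P.IsAdmissible) (n : ℕ) {A : Set P.Space} (hA : MeasurableSet A)
    {ε : ℝ≥0∞} (hε : ε ≠ 0) : ∃ M, n ≤ M ∧ ∀ m, M ≤ m → ∃ S : Set G,
      P.measure hP (P.level n ∩ symmDiff A (P.coord m ⁻¹' S)) ≤ ε := by
  -- The algebra asks for dependence on the coordinate in `F m` for all large `m`, not for one `m`;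
  -- this is what makes the approximation available at every level from `M` on.
  set 𝒜 : Set (Set P.Space) := {B | MeasurableSet B ∧ ∃ M, n ≤ M ∧ ∀ m, M ≤ m → ∃ S : Set G,
    ∀ x ∈ P.level n, x ∈ B ↔ P.coord m x ∈ S}
  have halg : IsSetAlgebra 𝒜 := by
    refine ⟨⟨MeasurableSet.empty, n, le_rfl, fun m _ => ⟨∅, by simp⟩⟩, ?_, ?_⟩
    · rintro B ⟨hB, M, hM, h⟩
      refine ⟨hB.compl, M, hM, fun m hm => ?_⟩
      obtain ⟨S, hS⟩ := h m hm
      exact ⟨Sᶜ, fun x hx => not_congr (hS x hx)⟩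
    · rintro B B' ⟨hB, M, hM, h⟩ ⟨hB', M', hM', h'⟩
      refine ⟨hB.union hB', max M M', by omega, fun m hm => ?_⟩
      obtain ⟨S, hS⟩ := h m (by omega)
      obtain ⟨S', hS'⟩ := h' m (by omega)
      exact ⟨S ∪ S', fun x hx => or_congr (hS x hx) (hS' x hx)⟩
  have hgen : (inferInstance : MeasurableSpace P.Space) = MeasurableSpace.generateFrom 𝒜 := by
    refine le_antisymm ?_ (MeasurableSpace.generateFrom_le fun B hB => hB.1)
    rw [generateFrom_box]
    refine MeasurableSpace.generateFrom_mono ?_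
    rintro _ ⟨k, a, rfl⟩
    refine ⟨measurableSet_box k a, max n k, le_max_left _ _, fun m hm => ?_⟩
    by_cases ha : a ∈ P.F k
    · refine ⟨{s | a⁻¹ * s ∈ blockSet P.C k m}, fun x hx => ?_⟩
      rw [mem_box_iff_of_le hP (show k ≤ m by omega) ha]
      exact and_iff_right (level_mono hP (by omega) hx)
    · exact ⟨∅, by simp [box_eq_empty ha]⟩
  have := isFiniteMeasure_restrict_level hP n
  have hdense := Measure.MeasureDense.of_generateFrom_isSetAlgebra_finite
    (μ := (P.measure hP).restrict (P.level n)) halg hgen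
  obtain ⟨δ, hδ0, hδ⟩ : ∃ δ : ℝ, 0 < δ ∧ ENNReal.ofReal δ ≤ ε := by
    refine ⟨(min ε 1).toReal, ENNReal.toReal_pos ?_ ?_, ?_⟩
    · simp [hε]
    · exact ne_top_of_le_ne_top ENNReal.one_ne_top (min_le_right _ _)
    · rw [ENNReal.ofReal_toReal (ne_top_of_le_ne_top ENNReal.one_ne_top (min_le_right _ _))]
      exact min_le_left _ _
  obtain ⟨B, ⟨hB, M, hM, h⟩, hlt⟩ := hdense.approx A hA (measure_ne_top _ _) δ hδ0
  rw [Measure.restrict_apply (hA.symmDiff hB)] at hlt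
  refine ⟨M, hM, fun m hm => ?_⟩
  obtain ⟨S, hS⟩ := h m hm
  refine ⟨S, le_trans (measure_mono ?_) (hlt.le.trans hδ)⟩
  rintro x ⟨hx, hx'⟩
  refine ⟨?_, hx⟩
  rw [Set.mem_symmDiff] at hx' ⊢
  rwa [hS x hx]

end CFData

/-! ### Odometers -/

instance {G : Type*} [Group G] [MeasurableSpace G] [DiscreteMeasurableSpace G] (H : Subgroup G) :
    DiscreteMeasurableSpace (G ⧸ H) :=
  ⟨fun _ => measurableSet_quotient.2 MeasurableSet.of_discrete⟩

instance {G : Type*} [Group G] [Countable G] (H : Subgroup G) : Countable (G ⧸ H) :=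
  QuotientGroup.mk_surjective.countable

theorem measurableSet_setOf_eventually {α : Type*} [MeasurableSpace α] {p : ℕ → α → Prop}
    (h : ∀ n, MeasurableSet {x | p n x}) : MeasurableSet {x | ∀ᶠ n in atTop, p n x} := by
  simp only [eventually_atTop, Set.ofPred_exists, Set.ofPred_forall]
  exact MeasurableSet.iUnion fun N => MeasurableSet.iInter fun n => MeasurableSet.iInter fun _ => h n

namespace OdometerSpace

variable {G : Type*} [Group G] {Γ : ℕ → Subgroup G}

@[simp]
theorem smul_coord (g : G) (y : OdometerSpace Γ) (n : ℕ) : (g • y).coord n = g • y.coord n := rfl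

theorem coord_eq_of_le (y : OdometerSpace Γ) {l m : ℕ} (h : l ≤ m) {g : G}
    (hg : y.coord m = (g : G ⧸ Γ m)) : y.coord l = (g : G ⧸ Γ l) := by
  induction m, h using Nat.le_induction with
  | base => exact hg
  | succ m hm ih => exact ih (y.coherent m g hg)

variable [MeasurableSpace G]

theorem measurable_iff {α : Type*} [MeasurableSpace α] {f : α → OdometerSpace Γ} :
    Measurable f ↔ ∀ n, Measurable fun x => (f x).coord n := by
  rw [measurable_comap_iff, measurable_pi_iff]
  rfl

theorem measurable_coord (n : ℕ) : Measurable fun y : OdometerSpace Γ => y.coord n :=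
  measurable_iff.1 measurable_id n

theorem measurable_smul [DiscreteMeasurableSpace G] (g : G) :
    Measurable fun y : OdometerSpace Γ => g • y :=
  measurable_iff.2 fun n =>
    (Measurable.of_discrete (f := fun a : G ⧸ Γ n => g • a)).comp (measurable_coord n)

/-- A measurable set in an odometer is approximated by sets that depend on one coordinate only. -/
theorem exists_approx [DiscreteMeasurableSpace G]
    (μ : Measure (OdometerSpace Γ)) [IsFiniteMeasure μ] {A : Set (OdometerSpace Γ)}
    (hA : MeasurableSet A) {ε : ℝ≥0∞} (hε : ε ≠ 0) :
    ∃ (l : ℕ) (D : Set (G ⧸ Γ l)), μ (symmDiff A {y | y.coord l ∈ D}) ≤ ε := by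
  set 𝒜 : Set (Set (OdometerSpace Γ)) := {B | ∃ (l : ℕ) (D : Set (G ⧸ Γ l)),
    B = {y | y.coord l ∈ D}}
  have hmeas : ∀ B ∈ 𝒜, MeasurableSet B := by
    rintro _ ⟨l, D, rfl⟩
    exact measurable_coord l MeasurableSet.of_discrete
  -- A condition on one coordinate is also a condition on any later one, so finite unions still
  -- depend on a single coordinate. Coherence of `y` makes the choice of representative harmless.
  have hlift : ∀ l m, l ≤ m → ∀ D : Set (G ⧸ Γ l), ∃ D' : Set (G ⧸ Γ m),
      {y : OdometerSpace Γ | y.coord l ∈ D} = {y | y.coord m ∈ D'} := by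
    intro l m h D
    refine ⟨{a | ∃ g : G, a = g ∧ (g : G ⧸ Γ l) ∈ D}, ?_⟩
    ext y
    obtain ⟨g, hg⟩ := QuotientGroup.mk_surjective (y.coord m)
    have := coord_eq_of_le y h hg.symm
    simp only [Set.mem_ofPred_eq, this]
    constructor
    · exact fun hD => ⟨g, hg.symm, hD⟩
    · rintro ⟨g', hg', hD⟩
      rw [← this, coord_eq_of_le y h hg']
      exact hD
  have halg : IsSetAlgebra 𝒜 := by
    refine ⟨⟨0, ∅, by simp⟩, ?_, ?_⟩
    · rintro _ ⟨l, D, rfl⟩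
      exact ⟨l, Dᶜ, rfl⟩
    · rintro _ _ ⟨l, D, rfl⟩ ⟨m, E, rfl⟩
      obtain ⟨D', hD'⟩ := hlift l (max l m) (le_max_left _ _) D
      obtain ⟨E', hE'⟩ := hlift m (max l m) (le_max_right _ _) E
      rw [hD', hE']
      exact ⟨max l m, D' ∪ E', rfl⟩
  have hgen : (inferInstance : MeasurableSpace (OdometerSpace Γ)) =
      MeasurableSpace.generateFrom 𝒜 := by
    refine le_antisymm ?_ (MeasurableSpace.generateFrom_le hmeas)
    have hid : @Measurable _ _ (MeasurableSpace.generateFrom 𝒜) _ (id : OdometerSpace Γ → _) :=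
      (@measurable_iff _ _ Γ _ _ (MeasurableSpace.generateFrom 𝒜) id).2 fun n D _ =>
        MeasurableSpace.measurableSet_generateFrom ⟨n, D, rfl⟩
    exact fun s hs => hid hs
  have hdense := Measure.MeasureDense.of_generateFrom_isSetAlgebra_finite (μ := μ) halg hgen
  obtain ⟨δ, hδ0, hδ⟩ : ∃ δ : ℝ, 0 < δ ∧ ENNReal.ofReal δ ≤ ε := by
    refine ⟨(min ε 1).toReal, ENNReal.toReal_pos ?_ ?_, ?_⟩
    · simp [hε]
    · exact ne_top_of_le_ne_top ENNReal.one_ne_top (min_le_right _ _)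
    · rw [ENNReal.ofReal_toReal (ne_top_of_le_ne_top ENNReal.one_ne_top (min_le_right _ _))]
      exact min_le_left _ _
  obtain ⟨_, ⟨l, D, rfl⟩, hlt⟩ := hdense.approx A hA (measure_ne_top _ _) δ hδ0
  exact ⟨l, D, hlt.le.trans hδ⟩

end OdometerSpace

namespace CFData

variable {G : Type*} [Group G] [MeasurableSpace G] {P : CFData G} {Γ : ℕ → Subgroup G}

/-! ### Nonsingular odometers as images of `(C,F)`-actions -/

section Map

variable [DiscreteMeasurableSpace G] [Countable G]

/-- The image of an infinite measure need not be `σ`-finite, so it is replaced by a finite measure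
with the same null sets. Quasi-invariance and ergodicity concern null sets only and pull back
through `π`. -/
theorem isNonsingularOdometer_map (hP : P.IsAdmissible) {π : P.Space → OdometerSpace Γ}
    (hπ : Measurable π) (he : ∀ g : G, ∀ᵐ x ∂(P.measure hP), π (P.T g x) = g • π x) :
    IsNonsingularOdometer Γ ((P.measure hP).toFinite.map π) := by
  have hnull : ∀ A, MeasurableSet A → ((P.measure hP).toFinite.map π A = 0 ↔
      P.measure hP (π ⁻¹' A) = 0) := fun A hA => by
    rw [Measure.map_apply hπ hA]
    exact ⟨fun h => absolutelyContinuous_toFinite _ h, fun h => toFinite_absolutelyContinuous _ h⟩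
  have hT : ∀ (g : G) (A : Set (OdometerSpace Γ)),
      P.T g ⁻¹' (π ⁻¹' A) =ᵐ[P.measure hP] π ⁻¹' ((fun y => g • y) ⁻¹' A) := by
    intro g A
    filter_upwards [he g] with x hx
    change (π (P.T g x) ∈ A) = (g • π x ∈ A)
    rw [hx]
  refine ⟨inferInstance, ?_, fun g => ⟨OdometerSpace.measurable_smul g, ?_⟩, fun A hA hinv => ?_⟩
  · rw [Ne, Measure.map_eq_zero_iff hπ.aemeasurable]
    intro h
    apply measure_ne_zero hP
    have := absolutelyContinuous_toFinite (P.measure hP)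
    rw [h] at this
    exact Measure.absolutelyContinuous_zero_iff.1 this
  · refine Measure.AbsolutelyContinuous.mk fun A hA h0 => ?_
    rw [Measure.map_apply (OdometerSpace.measurable_smul g) hA]
    rw [hnull _ (OdometerSpace.measurable_smul g hA), ← measure_congr (hT g A)]
    exact measure_T_preimage_eq_zero hP g (hπ hA) ((hnull A hA).1 h0)
  · rw [hnull A hA, hnull _ hA.compl]
    refine ergodic_T hP (hπ hA) fun g => (hT g A).trans ?_
    filter_upwards [absolutelyContinuous_toFinite (P.measure hP)
      (ae_of_ae_map hπ.aemeasurable (hinv g))] with x hx using hx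

theorem hasFactor_map (hP : P.IsAdmissible) {π : P.Space → OdometerSpace Γ}
    (hπ : Measurable π) (he : ∀ g : G, ∀ᵐ x ∂(P.measure hP), π (P.T g x) = g • π x) :
    P.HasFactor hP Γ ((P.measure hP).toFinite.map π) :=
  ⟨π, hπ, he, (absolutelyContinuous_toFinite _).map hπ, (toFinite_absolutelyContinuous _).map hπ⟩

end Map

/-! ### The limit map of a compatible telescoping -/

section Limit

/-- The cosets of the coordinates of `x` along `q` stabilize. -/
def Stabilizes (P : CFData G) (Γ : ℕ → Subgroup G) (q : ℕ → ℕ) (x : P.Space) : Prop :=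
  ∀ l, ∃ a : G ⧸ Γ l, ∀ᶠ k in atTop, (P.coord (q k) x : G ⧸ Γ l) = a

open Classical in
/-- The map to the odometer which sends `x` to the limit of its coordinates along `q`. -/
noncomputable def limitMap (P : CFData G) (hΓ : Antitone Γ) (q : ℕ → ℕ) (x : P.Space) :
    OdometerSpace Γ :=
  if h : P.Stabilizes Γ q x then
    ⟨fun l => (h l).choose, fun l g hg => by
      have h1 := (h l).choose_spec
      have h2 := (h (l + 1)).choose_spec
      obtain ⟨k, hk1, hk2⟩ := (h1.and h2).exists
      rw [← hk1]
      rw [← hk2, QuotientGroup.eq] at hg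
      exact QuotientGroup.eq.2 (hΓ (Nat.le_succ l) hg)⟩
  else
    -- The default value is the base point of the odometer.
    ⟨fun l => ((1 : G) : G ⧸ Γ l), fun l g hg => by
      rw [QuotientGroup.eq] at hg ⊢
      exact hΓ (Nat.le_succ l) hg⟩

theorem Stabilizes.eventually_eq {q : ℕ → ℕ} {x : P.Space} (h : P.Stabilizes Γ q x)
    (hΓ : Antitone Γ) (l : ℕ) :
    ∀ᶠ k in atTop, (P.coord (q k) x : G ⧸ Γ l) = (P.limitMap hΓ q x).coord l := by
  rw [limitMap, dif_pos h]
  exact (h l).choose_spec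

theorem limitMap_coord_eq_iff (hΓ : Antitone Γ) {q : ℕ → ℕ} {x : P.Space} (l : ℕ) (a : G ⧸ Γ l) :
    (P.limitMap hΓ q x).coord l = a ↔
      (P.Stabilizes Γ q x ∧ ∀ᶠ k in atTop, (P.coord (q k) x : G ⧸ Γ l) = a) ∨
        (¬ P.Stabilizes Γ q x ∧ ((1 : G) : G ⧸ Γ l) = a) := by
  by_cases h : P.Stabilizes Γ q x
  · simp only [h, true_and, not_true, false_and, or_false]
    constructor
    · rintro rfl
      exact h.eventually_eq hΓ l
    · intro h'
      obtain ⟨k, hk1, hk2⟩ := ((h.eventually_eq hΓ l).and h').exists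
      rw [← hk1, hk2]
  · simp only [h, false_and, not_false_eq_true, true_and, false_or]
    rw [limitMap, dif_neg h]

/-- Eventually the coordinates of `T g x` are `g` times those of `x`, so the limits of the cosets
differ by `g` as well. -/
theorem Stabilizes.T (hP : P.IsAdmissible) {q : ℕ → ℕ} (hq : Tendsto q atTop atTop) {x : P.Space}
    (h : P.Stabilizes Γ q x) (hΓ : Antitone Γ) {g : G} (hx : x ∈ P.dom g) :
    P.limitMap hΓ q (P.T g x) = g • P.limitMap hΓ q x := by
  have h1 := hq.eventually (eventually_T_mem_box hP hx)
  have h2 : ∀ l, ∀ᶠ k in atTop, (P.coord (q k) (P.T g x) : G ⧸ Γ l) =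
      g • (P.limitMap hΓ q x).coord l := by
    intro l
    filter_upwards [h1, h.eventually_eq hΓ l] with k hk1 hk2
    rw [coord_eq hP hk1.2.2, ← hk2]
    rfl
  have h3 : P.Stabilizes Γ q (P.T g x) := fun l => ⟨_, h2 l⟩
  refine OdometerSpace.ext (funext fun l => ?_)
  exact (limitMap_coord_eq_iff hΓ l _).2 (Or.inl ⟨h3, h2 l⟩)

variable [DiscreteMeasurableSpace G] [Countable G]

theorem measurableSet_eventually_coord_eq (hP : P.IsAdmissible) (q : ℕ → ℕ) (l : ℕ) (a : G ⧸ Γ l) :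
    MeasurableSet {x : P.Space | ∀ᶠ k in atTop, (P.coord (q k) x : G ⧸ Γ l) = a} :=
  measurableSet_setOf_eventually fun k =>
    measurable_coord hP (q k) (MeasurableSet.of_discrete (s := {g : G | (g : G ⧸ Γ l) = a}))

theorem measurableSet_stabilizes (hP : P.IsAdmissible) (q : ℕ → ℕ) :
    MeasurableSet {x : P.Space | P.Stabilizes Γ q x} := by
  simp only [Stabilizes, Set.ofPred_forall, Set.ofPred_exists]
  exact MeasurableSet.iInter fun l => MeasurableSet.iUnion fun a =>
    measurableSet_eventually_coord_eq hP q l a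

theorem measurable_limitMap (hP : P.IsAdmissible) (hΓ : Antitone Γ) (q : ℕ → ℕ) :
    Measurable (P.limitMap hΓ q) := by
  refine OdometerSpace.measurable_iff.2 fun l => measurable_to_countable' fun a => ?_
  have : (fun x : P.Space => (P.limitMap hΓ q x).coord l) ⁻¹' {a} =
      ({x | P.Stabilizes Γ q x} ∩ {x | ∀ᶠ k in atTop, (P.coord (q k) x : G ⧸ Γ l) = a}) ∪
        ({x | P.Stabilizes Γ q x}ᶜ ∩ {x | ((1 : G) : G ⧸ Γ l) = a}) := by
    ext x
    exact limitMap_coord_eq_iff hΓ l a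
  rw [this]
  exact ((measurableSet_stabilizes hP q).inter (measurableSet_eventually_coord_eq hP q l a)).union
    ((measurableSet_stabilizes hP q).compl.inter (MeasurableSet.const _))

/-- The law of an increment does not depend on the coordinate before it, so within each `X_N` the
increments outside `Γ n` have summable measure and Borel–Cantelli applies. Once `k ≥ l`, an
increment in `Γ k` does not change the coset modulo `Γ l`. -/
theorem ae_stabilizes (hP : P.IsAdmissible) (hΓ : Antitone Γ) {q : ℕ → ℕ} (hq : StrictMono q)
    (hc : (P.telescope q).IsCompatible Γ) : ∀ᵐ x ∂(P.measure hP), P.Stabilizes Γ q x := by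
  set B : ℕ → Set G := fun n => {c | c ∈ blockSet P.C (q n) (q (n + 1)) ∧ c ∉ Γ n}
  set bad : ℕ → Set P.Space := fun n => {x | (P.coord (q n) x)⁻¹ * P.coord (q (n + 1)) x ∈ B n}
  have hlev : ∀ N, ∀ᵐ x ∂(P.measure hP).restrict (P.level N), ∀ᶠ n in atTop, x ∉ bad (n + N) := by
    intro N
    refine ae_eventually_notMem ?_
    have hbound : ∀ n, (P.measure hP).restrict (P.level N) (bad (n + N)) ≤
        P.measure hP (P.level N) *
          blockConv P.κ (q (n + N)) (q (n + N + 1)) (B (n + N)) := by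
      intro n
      -- The shift by `N` guarantees that the increment starts at a level where all of `X_N` is
      -- already present.
      have hN : N ≤ q (n + N) := le_trans (by omega) (hq.le_apply)
      have := measure_coord_prod hP (hq.monotone (Nat.le_succ (n + N)))
        (P.F N * blockSet P.C N (q (n + N))) (B (n + N))
      rw [← measure_coord hP] at this
      have hlv := level_eq_of_le hP hN
      rw [← hlv] at this
      rw [← this, Measure.restrict_apply']
      · refine measure_mono ?_
        rintro x ⟨h1, h2⟩
        rw [hlv] at h2
        exact ⟨h2.1, h2.2, h1⟩
      · exact measurableSet_level N
    refine ne_top_of_le_ne_top ?_ (ENNReal.tsum_le_tsum hbound)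
    rw [ENNReal.tsum_mul_left]
    refine ENNReal.mul_ne_top (measure_level_ne_top hP N) (ne_top_of_le_ne_top hc.ne ?_)
    exact ENNReal.tsum_comp_le_tsum_of_injective (add_left_injective N)
      (fun n => blockConv P.κ (q n) (q (n + 1)) (B n))
  have hlev' : ∀ᵐ x ∂(P.measure hP), ∀ N, x ∈ P.level N → ∀ᶠ n in atTop, x ∉ bad (n + N) :=
    ae_all_iff.2 fun N => (ae_restrict_iff' (measurableSet_level N)).1 (hlev N)
  filter_upwards [hlev'] with x hx l
  obtain ⟨N, hN⟩ : ∃ N, x ∈ P.level N := exists_mem_box hP x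
  obtain ⟨K, hK⟩ := eventually_atTop.1 (hx N hN)
  set k₀ := max (K + N) l
  refine ⟨P.coord (q k₀) x, eventually_atTop.2 ⟨k₀, fun k hk => ?_⟩⟩
  induction k, hk using Nat.le_induction with
  | base => rfl
  | succ k hk ih =>
    rw [← ih, eq_comm, QuotientGroup.eq]
    have h1 := hK (k - N) (by omega)
    rw [Nat.sub_add_cancel (by omega)] at h1
    have h2 : (P.coord (q k) x)⁻¹ * P.coord (q (k + 1)) x ∈
        blockSet P.C (q k) (q (k + 1)) := by
      refine inv_coord_mul_coord_mem hP (hq.monotone (Nat.le_succ k)) ?_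
      exact level_mono hP (le_trans (by omega) hq.le_apply) hN
    by_contra hcon
    exact h1 ⟨h2, fun h3 => hcon (hΓ (by omega) h3)⟩

theorem limitMap_T (hP : P.IsAdmissible) (hΓ : Antitone Γ) {q : ℕ → ℕ} (hq : StrictMono q)
    (hc : (P.telescope q).IsCompatible Γ) (g : G) :
    ∀ᵐ x ∂(P.measure hP), P.limitMap hΓ q (P.T g x) = g • P.limitMap hΓ q x := by
  filter_upwards [ae_stabilizes hP hΓ hq hc, ae_mem_dom hP g] with x h1 h2
  exact h1.T hP hq.tendsto_atTop hΓ h2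

end Limit

end CFData

/-! ### Stabilizers of the coordinates of a point of the odometer -/

namespace OdometerSpace

variable {G : Type*} [Group G] {Γ : ℕ → Subgroup G}

/-- The sequence of the stabilizers of the coordinates of a point of the odometer. -/
def stab (y : OdometerSpace Γ) (n : ℕ) : Subgroup G := MulAction.stabilizer G (y.coord n)

theorem mem_stab_iff (y : OdometerSpace Γ) (n : ℕ) {x : G} :
    x ∈ y.stab n ↔ x • y.coord n = y.coord n := MulAction.mem_stabilizer_iff

theorem mem_stab_iff_of_eq (y : OdometerSpace Γ) {n : ℕ} {g x : G}
    (h : y.coord n = (g : G ⧸ Γ n)) : x ∈ y.stab n ↔ g⁻¹ * x * g ∈ Γ n := by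
  rw [mem_stab_iff, h, eq_comm]
  change ((g : G) : G ⧸ Γ n) = ((x * g : G) : G ⧸ Γ n) ↔ _
  rw [QuotientGroup.eq, mul_assoc]

/-- The stabilizer of `gΓ_n` is `gΓ_n g⁻¹`. By coherence a representative of the coordinate `n + 1`
also represents the coordinate `n`, so consecutive stabilizers are conjugated by the same `g` and
stay strictly nested; the intersection over all conjugates is unchanged. -/
theorem isOdometerSequence_stab (hΓ : IsOdometerSequence Γ) (y : OdometerSpace Γ) :
    IsOdometerSequence y.stab where
  strictAnti := by
    refine strictAnti_nat_of_succ_lt fun n => ?_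
    obtain ⟨g, hg⟩ := QuotientGroup.mk_surjective (y.coord (n + 1))
    have hg' := y.coherent n g hg.symm
    refine lt_of_le_of_ne (fun x hx => ?_) fun h => ?_
    · rw [mem_stab_iff_of_eq y hg.symm] at hx
      exact (mem_stab_iff_of_eq y hg').2 (hΓ.strictAnti.antitone (Nat.le_succ n) hx)
    · obtain ⟨x, hx, hx'⟩ := SetLike.exists_of_lt (hΓ.strictAnti (Nat.lt_succ_self n))
      have h1 : g * x * g⁻¹ ∈ y.stab n := (mem_stab_iff_of_eq y hg').2 (by
        rwa [show g⁻¹ * (g * x * g⁻¹) * g = x by group])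
      rw [← h, mem_stab_iff_of_eq y hg.symm, show g⁻¹ * (g * x * g⁻¹) * g = x by group] at h1
      exact hx' h1
  finiteIndex n := by
    have := hΓ.finiteIndex n
    refine ⟨?_⟩
    rw [stab, MulAction.index_stabilizer]
    have : (MulAction.orbit G (y.coord n)).Finite := Set.toFinite _
    exact (Set.ncard_pos this).2 ⟨_, MulAction.mem_orbit_self _⟩ |>.ne'
  iInter_conj := by
    have h1 : (1 : G) ∈ ⋂ (n : ℕ) (g : G), {x : G | ∃ γ ∈ y.stab n, x = g * γ * g⁻¹} :=
      Set.mem_iInter₂.2 fun n g => ⟨1, one_mem _, by group⟩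
    refine Set.Subset.antisymm ?_ (Set.singleton_subset_iff.2 h1)
    rw [← hΓ.iInter_conj]
    intro x hx
    rw [Set.mem_iInter₂] at hx ⊢
    intro n g
    obtain ⟨h, hh⟩ := QuotientGroup.mk_surjective (y.coord n)
    obtain ⟨γ, hγ, rfl⟩ := hx n (g * h⁻¹)
    exact ⟨h⁻¹ * γ * h, (mem_stab_iff_of_eq y hh.symm).1 hγ, by group⟩

end OdometerSpace

namespace CFData

variable {G : Type*} [Group G] [MeasurableSpace G] [DiscreteMeasurableSpace G] {P : CFData G}
  {Γ : ℕ → Subgroup G} {hP : P.IsAdmissible} {π : P.Space → OdometerSpace Γ}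

/-! ### Approximate constancy of an equivariant map on the boxes -/

/-- The proportion of the points of the box of `1` in `X_n` at which the `l`-th coordinate of the
map `π` is different from `a`. -/
noncomputable def defect (P : CFData G) (hP : P.IsAdmissible) (π : P.Space → OdometerSpace Γ)
    (n l : ℕ) (a : G ⧸ Γ l) : ℝ≥0∞ :=
  P.measure hP (P.box n 1 ∩ {x | (π x).coord l ≠ a}) / P.ν n {1}

theorem measurableSet_coord_mem (hπ : Measurable π) (l : ℕ) (D : Set (G ⧸ Γ l)) :
    MeasurableSet {x | (π x).coord l ∈ D} :=
  ((OdometerSpace.measurable_coord l).comp hπ) (MeasurableSet.of_discrete (s := D))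

theorem measure_box_one_inter_ne (n l : ℕ) (a : G ⧸ Γ l) :
    P.measure hP (P.box n 1 ∩ {x | (π x).coord l ≠ a}) = P.defect hP π n l a * P.ν n {1} := by
  rw [defect, ENNReal.div_mul_cancel (hP.ν_pos n 1 (hP.one_mem_F n)) (ν_ne_top hP n _)]

variable [Countable G]

theorem measure_coord_inter (hP : P.IsAdmissible) (n : ℕ) (S : Set G) {A : Set P.Space}
    (hA : MeasurableSet A) :
    P.measure hP (P.level n ∩ P.coord n ⁻¹' S ∩ A) = ∑' f : S, P.measure hP (P.box n f ∩ A) := by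
  rw [← measure_iUnion]
  · congr 1
    ext x
    simp only [Set.mem_inter_iff, Set.mem_preimage, Set.mem_iUnion, mem_box_iff hP, Subtype.exists,
      exists_prop]
    constructor
    · rintro ⟨⟨h1, h2⟩, h3⟩
      exact ⟨_, h2, ⟨h1, rfl⟩, h3⟩
    · rintro ⟨f, h2, ⟨h1, rfl⟩, h3⟩
      exact ⟨⟨h1, h2⟩, h3⟩
  · intro f f' hne
    refine Set.disjoint_left.2 fun x hx hx' => hne ?_
    exact Subtype.ext (eq_of_mem_box hP hx.1 hx'.1)
  · exact fun f => (measurableSet_box _ _).inter hA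

theorem ν_eq_tsum (hP : P.IsAdmissible) (n : ℕ) (S : Set G) :
    P.ν n S = ∑' f : S, P.ν n {(f : G)} := by
  have := measure_coord_inter hP n S MeasurableSet.univ
  simpa only [Set.inter_univ, measure_coord, measure_box] using this

theorem mul_ν_le_measure (hP : P.IsAdmissible) {n : ℕ} {S : Set G} {A : Set P.Space}
    (hA : MeasurableSet A) {r : ℝ≥0∞}
    (h : ∀ f ∈ S, r * P.ν n {f} ≤ P.measure hP (P.box n f ∩ A)) :
    r * P.ν n S ≤ P.measure hP (P.level n ∩ P.coord n ⁻¹' S ∩ A) := by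
  rw [measure_coord_inter hP n S hA, ν_eq_tsum hP, ← ENNReal.tsum_mul_left]
  exact ENNReal.tsum_le_tsum fun f => h f f.2

theorem measure_le_mul_ν (hP : P.IsAdmissible) {n : ℕ} {S : Set G} {A : Set P.Space}
    (hA : MeasurableSet A) {r : ℝ≥0∞}
    (h : ∀ f ∈ S, P.measure hP (P.box n f ∩ A) ≤ r * P.ν n {f}) :
    P.measure hP (P.level n ∩ P.coord n ⁻¹' S ∩ A) ≤ r * P.ν n S := by
  rw [measure_coord_inter hP n S hA, ν_eq_tsum hP, ← ENNReal.tsum_mul_left]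
  exact ENNReal.tsum_le_tsum fun f => h f f.2

/-- `T f` carries the box of `1` to the box of `f`, scales the measure there by a constant and
translates `π` by `f`. Hence one number, the defect, describes all boxes of level `n`. -/
theorem measure_box_inter_ne (hπ : Measurable π)
    (he : ∀ g : G, ∀ᵐ x ∂(P.measure hP), π (P.T g x) = g • π x) {n : ℕ} {f : G} (hf : f ∈ P.F n)
    (l : ℕ) (a : G ⧸ Γ l) :
    P.measure hP (P.box n f ∩ {x | (π x).coord l ≠ f • a}) =
      P.defect hP π n l a * P.ν n {f} := by
  have h1 := measure_box_inter_T_preimage hP (hP.one_mem_F n) (g := f) (by simpa using hf)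
    (measurableSet_coord_mem hπ l {b | b ≠ f • a})
  have h2 : P.measure hP (P.box n 1 ∩ P.T f ⁻¹' {x | (π x).coord l ∈ {b | b ≠ f • a}}) =
      P.measure hP (P.box n 1 ∩ {x | (π x).coord l ≠ a}) := by
    refine measure_congr ((ae_eq_refl _).inter ?_)
    filter_upwards [he f] with x hx
    change ((π (P.T f x)).coord l ≠ f • a) = ((π x).coord l ≠ a)
    rw [hx, OdometerSpace.smul_coord]
    simp
  rw [h2, measure_box_one_inter_ne, mul_one] at h1
  have h3 : P.ν n {1} * P.measure hP (P.box n f ∩ {x | (π x).coord l ≠ f • a}) =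
      P.ν n {1} * (P.defect hP π n l a * P.ν n {f}) := by
    refine Eq.trans h1.symm ?_
    ring
  exact (ENNReal.mul_right_inj (hP.ν_pos n 1 (hP.one_mem_F n)) (ν_ne_top hP n _)).1 h3

/-- Some set `E`, where the coordinate is `b`, has positive measure in `X_0` and is nearly a union
of boxes of level `m`. If all defects exceeded `ε`, every box of `f` would have more than the
proportion `ε` outside `E` (use `a = f⁻¹ • b`), contradicting a good approximation. -/
theorem eventually_exists_defect_le (hπ : Measurable π)
    (he : ∀ g : G, ∀ᵐ x ∂(P.measure hP), π (P.T g x) = g • π x) (l : ℕ) {ε : ℝ≥0∞} (hε : ε ≠ 0) :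
    ∀ᶠ n in atTop, ∃ a, P.defect hP π n l a ≤ ε := by
  wlog hε1 : ε ≤ 1 generalizing ε
  · filter_upwards [this one_ne_zero le_rfl] with n ⟨a, ha⟩
    exact ⟨a, ha.trans (not_le.1 hε1).le⟩
  obtain ⟨b, hb⟩ : ∃ b : G ⧸ Γ l, P.measure hP (P.level 0 ∩ {x | (π x).coord l ∈ ({b} : Set _)}) ≠
      0 := by
    by_contra! hcon
    have h0 : P.measure hP (P.level 0) = 0 := by
      refine measure_mono_null (t := ⋃ b : G ⧸ Γ l, P.level 0 ∩
        {x | (π x).coord l ∈ ({b} : Set _)}) ?_ (measure_iUnion_null hcon)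
      intro x hx
      exact Set.mem_iUnion.2 ⟨(π x).coord l, hx, rfl⟩
    rw [measure_level] at h0
    exact hP.ν_pos 0 1 (hP.one_mem_F 0)
      (measure_mono_null (Set.singleton_subset_iff.2 (hP.one_mem_F 0)) h0)
  set E : Set P.Space := {x | (π x).coord l ∈ ({b} : Set _)} with hE
  have hEm : MeasurableSet E := measurableSet_coord_mem hπ l {b}
  set e := P.measure hP (P.level 0 ∩ E)
  have he_top : e ≠ ∞ := measure_ne_top_of_subset Set.inter_subset_left (measure_level_ne_top hP 0)
  have hεt : ε ≠ ∞ := ne_top_of_le_ne_top ENNReal.one_ne_top hε1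
  -- With error `η`, the two estimates combine to `ε * e ≤ η + ε * η ≤ 2 * η`, which is half of `ε *
  -- e`. The reduction to `ε ≤ 1` gives the second inequality.
  set η := ε * e / 2 / 2 with hη
  have hεe : ε * e ≠ 0 := mul_ne_zero hε hb
  have hη0 : η ≠ 0 := by simp [hη, hε, hb]
  obtain ⟨M, hM, hS⟩ := exists_approx hP 0 hEm hη0
  filter_upwards [eventually_ge_atTop M] with m hm
  obtain ⟨S, hS⟩ := hS m hm
  by_contra! hcon
  set S' : Set G := S ∩ (P.F 0 * blockSet P.C 0 m)
  have hlev : P.level m ∩ P.coord m ⁻¹' S' = P.level 0 ∩ P.coord m ⁻¹' S := by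
    rw [level_eq_of_le hP (Nat.zero_le m), Set.preimage_inter, Set.inter_assoc,
      Set.inter_comm (P.coord m ⁻¹' S)]
  have h1 : ε * P.ν m S' ≤ P.measure hP (P.level m ∩ P.coord m ⁻¹' S' ∩ Eᶜ) := by
    refine mul_ν_le_measure hP hEm.compl fun f _ => ?_
    by_cases hf : f ∈ P.F m
    · have := measure_box_inter_ne hπ he hf l (f⁻¹ • b)
      rw [smul_inv_smul] at this
      exact (mul_le_mul_left (hcon (f⁻¹ • b)).le _).trans this.ge
    · rw [ν_eq_zero hP hf, mul_zero]
      exact zero_le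
  rw [← measure_coord hP, hlev] at h1
  have h2 : P.measure hP (P.level 0 ∩ P.coord m ⁻¹' S ∩ Eᶜ) ≤ η :=
    (measure_mono fun x hx => show x ∈ P.level 0 ∩ symmDiff E (P.coord m ⁻¹' S) from
      ⟨hx.1.1, Or.inr ⟨hx.1.2, hx.2⟩⟩).trans hS
  have h3 : e ≤ P.measure hP (P.level 0 ∩ P.coord m ⁻¹' S) + η := by
    refine le_trans ?_ (add_le_add_right hS _)
    refine le_trans (measure_mono fun x hx => ?_) (measure_union_le _ _)
    by_cases hxS : x ∈ P.coord m ⁻¹' S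
    · exact Or.inl ⟨hx.1, hxS⟩
    · exact Or.inr ⟨hx.1, Or.inl ⟨hx.2, hxS⟩⟩
  have h4 : ε * e ≤ ε * e / 2 := calc
    ε * e ≤ ε * (P.measure hP (P.level 0 ∩ P.coord m ⁻¹' S) + η) := mul_le_mul_right h3 _
    _ = ε * P.measure hP (P.level 0 ∩ P.coord m ⁻¹' S) + ε * η := mul_add _ _ _
    _ ≤ η + 1 * η := add_le_add (h1.trans h2) (mul_le_mul_left hε1 _)
    _ = ε * e / 2 := by rw [one_mul, hη, ENNReal.add_halves]
  exact absurd h4 (not_le.2 (ENNReal.half_lt_self hεe (ENNReal.mul_ne_top hεt he_top)))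

/-- Two exceptional sets of proportion at most a quarter cannot cover the box of `1`. This gives
both coherence and uniqueness of the limiting cosets. -/
theorem exists_mem_box_coord_eq {n l k : ℕ} {a : G ⧸ Γ l} {b : G ⧸ Γ k}
    (ha : P.defect hP π n l a ≤ 1 / 4) (hb : P.defect hP π n k b ≤ 1 / 4) :
    ∃ x, (π x).coord l = a ∧ (π x).coord k = b := by
  by_contra! hcon
  have hν := hP.ν_pos n 1 (hP.one_mem_F n)
  have h1 : P.ν n {1} ≤ P.ν n {1} / 2 := calc
    P.ν n {1} = P.measure hP (P.box n 1) := (measure_box hP n 1).symm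
    _ ≤ P.measure hP (P.box n 1 ∩ {x | (π x).coord l ≠ a}) +
        P.measure hP (P.box n 1 ∩ {x | (π x).coord k ≠ b}) := by
      refine le_trans (measure_mono fun x hx => ?_) (measure_union_le _ _)
      by_cases hxa : (π x).coord l = a
      · exact Or.inr ⟨hx, hcon x hxa⟩
      · exact Or.inl ⟨hx, hxa⟩
    _ ≤ 1 / 4 * P.ν n {1} + 1 / 4 * P.ν n {1} := by
      rw [measure_box_one_inter_ne, measure_box_one_inter_ne]
      gcongr
    _ = P.ν n {1} / 2 := by
      rw [← add_mul, ENNReal.div_eq_inv_mul (a := P.ν n {1})]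
      congr 1
      rw [← one_div, show (1 : ℝ≥0∞) / 4 = 1 / 2 / 2 by
        rw [div_eq_mul_inv, div_eq_mul_inv, div_eq_mul_inv, one_mul, one_mul,
          ← ENNReal.mul_inv (by simp) (by simp)]
        norm_num]
      exact ENNReal.add_halves _
  exact absurd h1 (not_le.2 (ENNReal.half_lt_self hν (ν_ne_top hP n _)))

/-- The coset of small defect may vary with `n`, but it has finitely many values, so an ultrafilter
selects one. The coset selected for `ε = 1 / 4` is the one for every smaller `ε`, because two cosets
of defect at most `1 / 4` at the same level coincide. -/
theorem exists_limit_point (hΓ : ∀ n, (Γ n).FiniteIndex) (hπ : Measurable π)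
    (he : ∀ g : G, ∀ᵐ x ∂(P.measure hP), π (P.T g x) = g • π x) :
    ∃ y : OdometerSpace Γ, ∀ l, ∀ ε ≠ 0,
      ∀ᶠ n in (hyperfilter ℕ : Filter ℕ), P.defect hP π n l (y.coord l) ≤ ε := by
  have hle : (hyperfilter ℕ : Filter ℕ) ≤ atTop := by
    rw [← Nat.cofinite_eq_atTop]
    exact hyperfilter_le_cofinite
  have h1 : ∀ l, ∀ ε ≠ 0, ∃ a : G ⧸ Γ l, ∀ᶠ n in (hyperfilter ℕ : Filter ℕ),
      P.defect hP π n l a ≤ ε := by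
    intro l ε hε
    have := hΓ l
    exact Ultrafilter.eventually_exists_iff.1 (hle (eventually_exists_defect_le hπ he l hε))
  have h4 : (1 / 4 : ℝ≥0∞) ≠ 0 := by simp
  choose a ha using fun l => h1 l _ h4
  refine ⟨⟨a, fun l g hg => ?_⟩, fun l ε hε => ?_⟩
  · obtain ⟨n, hn, hn'⟩ := ((ha l).and (ha (l + 1))).exists
    obtain ⟨x, hx, hx'⟩ := exists_mem_box_coord_eq hn hn'
    rw [← hx]
    exact (π x).coherent l g (hx'.trans hg)
  · obtain ⟨b, hb⟩ := h1 l (min ε (1 / 4)) (by simp [hε])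
    obtain ⟨n, hn, hn'⟩ := ((ha l).and hb).exists
    obtain ⟨x, hx, hx'⟩ := exists_mem_box_coord_eq hn (hn'.trans (min_le_right _ _))
    have : a l = b := hx.symm.trans hx'
    filter_upwards [hb] with n hn
    rw [this]
    exact hn.trans (min_le_left _ _)

/-- If `c • a ≠ a`, then on at least half of the box of `c` at level `m` the coordinate is `c • a`,
hence not `a`. These boxes lie in the box of `1` at level `n`, where deviation from `a` is limited
by the defect; the factor `2` undoes the half. -/
theorem blockConv_ne_le (hπ : Measurable π)
    (he : ∀ g : G, ∀ᵐ x ∂(P.measure hP), π (P.T g x) = g • π x) {n m : ℕ} (h : n ≤ m) (l : ℕ)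
    (a : G ⧸ Γ l) (hm : P.defect hP π m l a ≤ 1 / 2) :
    blockConv P.κ n m {c | c ∈ blockSet P.C n m ∧ c • a ≠ a} ≤ 2 * P.defect hP π n l a := by
  set B : Set G := {c | c ∈ blockSet P.C n m ∧ c • a ≠ a} with hB
  have hA : MeasurableSet {x | (π x).coord l ≠ a} := measurableSet_coord_mem hπ l {b | b ≠ a}
  have h1 : 2⁻¹ * P.ν m B ≤
      P.measure hP (P.level m ∩ P.coord m ⁻¹' B ∩ {x | (π x).coord l ≠ a}) := by
    refine mul_ν_le_measure hP hA fun f hf => ?_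
    have hfF : f ∈ P.F m := hP.blockSet_subset h hf.1
    have h2 : P.ν m {f} ≤ P.measure hP (P.box m f ∩ {x | (π x).coord l ≠ a}) + 2⁻¹ * P.ν m {f} := by
      rw [← measure_box hP]
      refine le_trans (measure_mono (t := (P.box m f ∩ {x | (π x).coord l ≠ a}) ∪
        (P.box m f ∩ {x | (π x).coord l ≠ f • a})) fun x hx => ?_)
        ((measure_union_le _ _).trans (add_le_add_right ?_ _))
      · by_cases hxa : (π x).coord l = a
        · right
          refine ⟨hx, fun h' => hf.2 ?_⟩
          rw [← h', hxa]
        · exact Or.inl ⟨hx, hxa⟩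
      · rw [measure_box_inter_ne hπ he hfF, measure_box, ← one_div]
        gcongr
    have h3 : 2⁻¹ * P.ν m {f} + 2⁻¹ * P.ν m {f} = P.ν m {f} := by
      rw [← add_mul, ENNReal.inv_two_add_inv_two, one_mul]
    conv_lhs at h2 => rw [← h3]
    exact (ENNReal.add_le_add_iff_right
      (ENNReal.mul_ne_top (by simp) (ν_ne_top hP m _))).1 h2
  have h2 : P.level m ∩ P.coord m ⁻¹' B =
      P.level n ∩ {x | P.coord n x ∈ ({1} : Set G) ∧ (P.coord n x)⁻¹ * P.coord m x ∈ B} := by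
    ext x
    constructor
    · rintro ⟨hx, hx'⟩
      have hxb : x ∈ P.box n 1 :=
        (mem_box_iff_of_le hP h (hP.one_mem_F n)).2 ⟨hx, by simpa using hx'.1⟩
      have := coord_eq hP hxb
      refine ⟨⟨_, hxb⟩, this, ?_⟩
      rw [this]
      simpa using hx'
    · rintro ⟨hx, hx1, hx'⟩
      rw [Set.mem_singleton_iff.1 hx1] at hx'
      exact ⟨level_mono hP h hx, by simpa using hx'⟩
  have h3 : P.level m ∩ P.coord m ⁻¹' B ⊆ P.box n 1 := by
    rw [h2]
    exact fun x hx => (mem_box_iff hP).2 ⟨hx.1, hx.2.1⟩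
  have h4 : P.ν m B = P.ν n {1} * blockConv P.κ n m B := by
    rw [← measure_coord hP, h2, measure_coord_prod hP h]
  have h5 : 2⁻¹ * P.ν m B ≤ P.defect hP π n l a * P.ν n {1} := by
    rw [← measure_box_one_inter_ne]
    exact h1.trans (measure_mono (Set.inter_subset_inter_left _ h3))
  rw [h4, mul_left_comm, mul_comm (P.defect hP π n l a)] at h5
  have h6 := (ENNReal.mul_le_mul_iff_right (hP.ν_pos n 1 (hP.one_mem_F n)) (ν_ne_top hP n _)).1 h5
  calc blockConv P.κ n m B = 2 * (2⁻¹ * blockConv P.κ n m B) := by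
        rw [← mul_assoc, ENNReal.mul_inv_cancel (by simp) (by simp), one_mul]
    _ ≤ _ := mul_le_mul_right h6 _

/-- An equivariant map to an odometer gives a telescoping which is compatible with a sequence of
subgroups that are conjugate to the given ones. -/
theorem exists_compatible (hΓ : IsOdometerSequence Γ) (hπ : Measurable π)
    (he : ∀ g : G, ∀ᵐ x ∂(P.measure hP), π (P.T g x) = g • π x) :
    ∃ (y : OdometerSpace Γ) (q : ℕ → ℕ), q 0 = 0 ∧ StrictMono q ∧
      (P.telescope q).IsCompatible y.stab ∧
      ∀ k, 1 ≤ k → ∀ l, l ≤ k → P.defect hP π (q k) l (y.coord l) ≤ 2⁻¹ ^ (k + 1) := by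
  obtain ⟨y, hy⟩ := exists_limit_point hΓ.finiteIndex hπ he
  have hle : (hyperfilter ℕ : Filter ℕ) ≤ atTop := by
    rw [← Nat.cofinite_eq_atTop]
    exact hyperfilter_le_cofinite
  -- Only finitely many `l ≤ k` are involved, so the ultrafilter gives a common set of levels `n`,
  -- and that set is unbounded.
  have hfreq : ∀ k, ∃ᶠ n in atTop,
      ∀ l, l ≤ k → P.defect hP π n l (y.coord l) ≤ 2⁻¹ ^ (k + 1) := by
    intro k
    refine Frequently.filter_mono (Eventually.frequently ?_) hle
    exact (Set.finite_Iic k).eventually_all.2 fun l _ => hy l _ (by simp)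
  obtain ⟨φ, hφ, hφ'⟩ := extraction_forall_of_frequently hfreq
  -- The value `q 0 = 0` is imposed, so no defect bound is known at `k = 0`; that term of the series
  -- is bounded by `1` instead.
  set q : ℕ → ℕ := fun k => if k = 0 then 0 else φ k with hq
  have hqφ : ∀ k, 1 ≤ k → q k = φ k := fun k hk => if_neg (by omega)
  have hqm : StrictMono q := by
    refine strictMono_nat_of_lt_succ fun k => ?_
    rw [hqφ (k + 1) (by omega)]
    by_cases hk : k = 0
    · subst hk
      exact lt_of_lt_of_le (by simp [hq]) (hφ.le_apply : 1 ≤ φ 1)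
    · rw [hqφ k (by omega)]
      exact hφ (Nat.lt_succ_self k)
  have hdef : ∀ k, 1 ≤ k → ∀ l, l ≤ k → P.defect hP π (q k) l (y.coord l) ≤ 2⁻¹ ^ (k + 1) :=
    fun k hk => by
      rw [hqφ k hk]
      exact hφ' k
  refine ⟨y, q, rfl, hqm, ?_, hdef⟩
  have hbound : ∀ k, (P.telescope q).κ k {c | c ∈ (P.telescope q).C k ∧ c ∉ y.stab k} ≤
      2⁻¹ ^ k := by
    intro k
    have hk1 := hqm.monotone (Nat.le_succ k)
    rcases Nat.eq_zero_or_pos k with rfl | hk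
    · have : IsProbabilityMeasure ((P.telescope q).κ 0) := isProbabilityMeasure_blockConv hP hk1
      rw [pow_zero]
      exact prob_le_one
    · have hset : {c | c ∈ (P.telescope q).C k ∧ c ∉ y.stab k} =
          {c | c ∈ blockSet P.C (q k) (q (k + 1)) ∧ c • y.coord k ≠ y.coord k} := by
        ext c
        exact and_congr_right fun _ => not_congr (y.mem_stab_iff k)
      rw [hset]
      refine (blockConv_ne_le hπ he hk1 k _ ?_).trans ?_
      · refine (hdef (k + 1) (by omega) k (by omega)).trans ?_
        rw [one_div]
        exact pow_le_of_le_one (by simp) (by simp) (by omega)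
      · refine (mul_le_mul_right (hdef k hk k le_rfl) _).trans ?_
        rw [pow_succ', ← mul_assoc, ENNReal.mul_inv_cancel (by simp) (by simp), one_mul]
  refine lt_of_le_of_lt (ENNReal.tsum_le_tsum hbound) ?_
  rw [ENNReal.tsum_geometric, ENNReal.one_sub_inv_two, inv_inv]
  exact ENNReal.ofNat_lt_top

end CFData

namespace CFData

variable {G : Type*} [Group G] [MeasurableSpace G] [DiscreteMeasurableSpace G] [Countable G]
  {P : CFData G} {Γ : ℕ → Subgroup G} {hP : P.IsAdmissible} {π : P.Space → OdometerSpace Γ}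

/-! ### Non-atomicity -/

theorem blockConv_singleton_le (hP : P.IsAdmissible) {n m : ℕ} (h : n ≤ m) {b : G}
    (hb : b ∈ blockSet P.C n m) :
    blockConv P.κ n m {b} ≤ ∏ k ∈ Finset.Ico n m, ⨆ c ∈ P.C k, P.κ k {c} := by
  induction m, h using Nat.le_induction generalizing b with
  | base =>
    have := isProbabilityMeasure_blockConv hP (le_refl n)
    simpa using prob_le_one
  | succ m hm ih =>
    rw [blockSet_succ _ hm] at hb
    obtain ⟨b, hb, c, hc, rfl⟩ := hb
    rw [blockConv_succ_singleton hP hm hb hc, Finset.prod_Ico_succ_top hm]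
    exact mul_le_mul' (ih hb) (le_iSup₂ (f := fun c (_ : c ∈ P.C m) => P.κ m {c}) c hc)

theorem ν_singleton_le (hP : P.IsAdmissible) {n m : ℕ} (h : n ≤ m) {f : G}
    (hf : f ∈ P.F n * blockSet P.C n m) :
    P.ν m {f} ≤ P.ν n (P.F n) * ∏ k ∈ Finset.Ico n m, ⨆ c ∈ P.C k, P.κ k {c} := by
  obtain ⟨a, ha, b, hb, rfl⟩ := hf
  rw [ν_mul_blockSet hP h ha hb]
  exact mul_le_mul' (measure_mono (Set.singleton_subset_iff.2 ha)) (blockConv_singleton_le hP h hb)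

/-- The elements `f` such that the set `A` fills more than half of the box of `f` lie in a single
orbit of the group of elements that do not move `A` off itself. -/
theorem mul_inv_mem_of_measure_lt (hP : P.IsAdmissible) {A : Set P.Space} (hA : MeasurableSet A)
    {S : Set G} (hS : ∀ g ∉ S, ∀ᵐ x ∂P.measure hP, x ∈ A → P.T g x ∉ A) {n : ℕ} {f f' : G}
    (hf : f ∈ P.F n) (hf' : f' ∈ P.F n) (h : P.measure hP (P.box n f ∩ Aᶜ) < P.ν n {f} / 2)
    (h' : P.measure hP (P.box n f' ∩ Aᶜ) < P.ν n {f'} / 2) : f' * f⁻¹ ∈ S := by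
  by_contra hg
  set g := f' * f⁻¹
  have hgf : g * f = f' := inv_mul_cancel_right f' f
  have h1 := measure_box_inter_T_preimage hP hf (g := g) (by rwa [hgf]) hA.compl
  rw [hgf] at h1
  -- Being more than half filled transfers from the box of `f'` back to the box of `f`. If `g` moved
  -- `A` off itself, `Aᶜ` and its preimage would cover the box of `f`, each with less than half of
  -- the mass.
  have h2 : P.measure hP (P.box n f ∩ P.T g ⁻¹' Aᶜ) < P.ν n {f} / 2 := by
    have h3 : P.ν n {f'} * P.measure hP (P.box n f ∩ P.T g ⁻¹' Aᶜ) <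
        P.ν n {f'} * (P.ν n {f} / 2) := by
      rw [h1, ← mul_div_assoc, mul_comm (P.ν n {f'}), mul_div_assoc]
      exact ENNReal.mul_lt_mul_right (hP.ν_pos n f hf) (ν_ne_top hP n _) h'
    exact lt_of_mul_lt_mul_left' h3
  have h3 : P.ν n {f} < P.ν n {f} := calc
    P.ν n {f} = P.measure hP (P.box n f) := (measure_box hP n f).symm
    _ ≤ P.measure hP ((P.box n f ∩ Aᶜ) ∪ (P.box n f ∩ P.T g ⁻¹' Aᶜ)) := by
      refine measure_mono_ae ?_
      filter_upwards [hS g hg] with x hx hxf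
      by_cases hxA : x ∈ A
      · exact Or.inr ⟨hxf, hx hxA⟩
      · exact Or.inl ⟨hxf, hxA⟩
    _ ≤ _ := measure_union_le _ _
    _ < P.ν n {f} / 2 + P.ν n {f} / 2 := ENNReal.add_lt_add h h2
    _ = P.ν n {f} := ENNReal.add_halves _
  exact lt_irrefl _ h3

/-- A measurable set which is disjoint from its images under all but finitely many of the
transformations `T g` is null. -/
theorem measure_eq_zero_of_finite (hP : P.IsAdmissible) {A : Set P.Space} (hA : MeasurableSet A)
    {S : Set G} (hSf : S.Finite) (hS : ∀ g ∉ S, ∀ᵐ x ∂P.measure hP, x ∈ A → P.T g x ∉ A) :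
    P.measure hP A = 0 := by
  by_contra hne
  obtain ⟨n, hn⟩ : ∃ n, P.measure hP (P.level n ∩ A) ≠ 0 := by
    by_contra! hcon
    refine hne (measure_mono_null (t := ⋃ n, P.level n ∩ A) ?_ (measure_iUnion_null hcon))
    rw [← Set.iUnion_inter, iUnion_level hP, Set.univ_inter]
  set e := P.measure hP (P.level n ∩ A)
  have he : e ≠ ∞ := measure_ne_top_of_subset Set.inter_subset_left (measure_level_ne_top hP n)
  -- The less than half filled boxes of the approximation weigh at most `2 * η`, and the
  -- approximation error is `η`. Together they stay below `e / 2`, which leaves `e / 2` for the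
  -- boxes that are more than half filled.
  set η := e / 2 / 2 / 2 with hη
  have hη0 : η ≠ 0 := by simp [hη, hn]
  obtain ⟨M, hM, hU⟩ := exists_approx hP n hA hη0
  -- Fixing one box that is more than half filled, the others differ from it by left multiplication
  -- by elements of `S`; so `r m` is the number of elements of `S` times a bound for one box.
  set r : ℕ → ℝ≥0∞ := fun m =>
    hSf.toFinset.card * (P.ν n (P.F n) * ∏ k ∈ Finset.Ico n m, ⨆ c ∈ P.C k, P.κ k {c})
  have hr : Tendsto r atTop (𝓝 0) := by
    have := ENNReal.Tendsto.const_mul (a := (hSf.toFinset.card : ℝ≥0∞)) (ENNReal.Tendsto.const_mul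
      (tendsto_prod_Ico hP n) (Or.inr (ν_ne_top hP n (P.F n)))) (Or.inr (ENNReal.natCast_ne_top _))
    simpa using this
  have hkey : ∀ m, M ≤ m → e / 2 ≤ r m := by
    intro m hm
    obtain ⟨U, hU⟩ := hU m hm
    have hnm : n ≤ m := hM.trans hm
    set L : Set G := P.F n * blockSet P.C n m
    have hL : P.level n = P.level m ∩ P.coord m ⁻¹' L := level_eq_of_le hP hnm
    set D : Set G := {f | f ∈ L ∧ P.measure hP (P.box m f ∩ Aᶜ) < P.ν m {f} / 2} with hD
    set B : Set G := (U ∩ L) \ D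
    have hLF : L ⊆ P.F m := by
      rintro _ ⟨a, ha, b, hb, rfl⟩
      exact hP.mul_blockSet_mem hnm ha hb
    have hDr : P.ν m D ≤ r m := by
      rcases D.eq_empty_or_nonempty with h0 | ⟨f₀, hf₀⟩
      · rw [h0, measure_empty]
        exact zero_le
      · have hsub : D ⊆ ⋃ s ∈ hSf.toFinset, {f | f = s * f₀ ∧ f ∈ L} := by
          intro f hf
          have := mul_inv_mem_of_measure_lt hP hA hS (hLF hf₀.1) (hLF hf.1) hf₀.2 hf.2
          exact Set.mem_iUnion₂.2 ⟨_, hSf.mem_toFinset.2 this, by simp, hf.1⟩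
        refine (measure_mono hsub).trans ((measure_biUnion_finset_le _ _).trans ?_)
        refine (Finset.sum_le_card_nsmul _ _ _ fun s _ => ?_).trans_eq (nsmul_eq_mul _ _)
        by_cases hs : s * f₀ ∈ L
        · refine le_trans (measure_mono ?_) (ν_singleton_le hP hnm hs)
          exact fun f hf => hf.1
        · refine le_of_eq_of_le ?_ zero_le
          convert measure_empty (μ := P.ν m)
          refine Set.eq_empty_of_forall_notMem ?_
          rintro f ⟨rfl, h2⟩
          exact hs h2
    have hB : 2⁻¹ * P.ν m B ≤ η := by
      refine (mul_ν_le_measure hP hA.compl fun f hf => ?_).trans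
        ((measure_mono (fun x hx => ?_)).trans hU)
      · have := not_lt.1 (fun h => hf.2 ⟨hf.1.2, h⟩)
        rwa [ENNReal.div_eq_inv_mul] at this
      · refine ⟨?_, Or.inr ⟨hx.1.2.1.1, hx.2⟩⟩
        rw [hL]
        exact ⟨hx.1.1, hx.1.2.1.2⟩
    have hB' : P.ν m B ≤ e / 2 / 2 := by
      calc P.ν m B = 2⁻¹ * P.ν m B + 2⁻¹ * P.ν m B := by
            rw [← add_mul, ENNReal.inv_two_add_inv_two, one_mul]
        _ ≤ η + η := add_le_add hB hB
        _ = e / 2 / 2 := ENNReal.add_halves _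
    have hηle : η ≤ e / 2 / 2 := ENNReal.half_le_self
    have hsum : e ≤ r m + e / 2 := calc
      e ≤ P.measure hP ((P.level m ∩ P.coord m ⁻¹' D) ∪ ((P.level m ∩ P.coord m ⁻¹' B) ∪
          (P.level n ∩ symmDiff A (P.coord m ⁻¹' U)))) := by
        refine measure_mono fun x hx => ?_
        have hx1 := hx.1
        rw [hL] at hx1
        by_cases hxD : P.coord m x ∈ D
        · exact Or.inl ⟨hx1.1, hxD⟩
        by_cases hxU : P.coord m x ∈ U
        · exact Or.inr (Or.inl ⟨hx1.1, ⟨hxU, hx1.2⟩, hxD⟩)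
        · exact Or.inr (Or.inr ⟨hx.1, Or.inl ⟨hx.2, hxU⟩⟩)
      _ ≤ P.ν m D + (P.ν m B + η) := by
        refine (measure_union_le _ _).trans (add_le_add (measure_coord hP m D).le ?_)
        exact (measure_union_le _ _).trans (add_le_add (measure_coord hP m B).le hU)
      _ ≤ r m + (e / 2 / 2 + e / 2 / 2) := add_le_add hDr (add_le_add hB' hηle)
      _ = r m + e / 2 := by rw [ENNReal.add_halves]
    conv_lhs at hsum => rw [← ENNReal.add_halves e]
    exact (ENNReal.add_le_add_iff_right (ENNReal.div_ne_top he (by simp))).1 hsum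
  have := ge_of_tendsto hr (eventually_atTop.2 ⟨M, hkey⟩)
  simp [hn] at this

/-- The fibre over `y` meets its image under `T g` in positive measure only if `g` fixes every
coordinate of `y`. -/
theorem nullSingletonClass_map (hπ : Measurable π)
    (he : ∀ g : G, ∀ᵐ x ∂(P.measure hP), π (P.T g x) = g • π x)
    (hfin : ∀ y : OdometerSpace Γ, (⋂ n, (y.stab n : Set G)).Finite) :
    NullSingletonClass ((P.measure hP).toFinite.map π) := by
  refine ⟨fun y => ?_⟩
  have hy : MeasurableSet ({y} : Set (OdometerSpace Γ)) := by
    have : ({y} : Set (OdometerSpace Γ)) = ⋂ n, {z | z.coord n ∈ ({y.coord n} : Set _)} := by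
      ext z
      rw [Set.mem_singleton_iff, OdometerSpace.ext_iff, funext_iff]
      simp
    rw [this]
    exact MeasurableSet.iInter fun n =>
      OdometerSpace.measurable_coord n (MeasurableSet.of_discrete (s := {y.coord n}))
  rw [Measure.map_apply hπ hy]
  refine toFinite_absolutelyContinuous _ (measure_eq_zero_of_finite hP (hπ hy) (hfin y) ?_)
  intro g hg
  filter_upwards [he g] with x hx hxy hxy'
  refine hg (Set.mem_iInter.2 fun n => (y.mem_stab_iff n).2 ?_)
  rw [Set.mem_preimage, Set.mem_singleton_iff] at hxy hxy'
  rw [hx, hxy] at hxy'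
  exact congrArg (fun z => z.coord n) hxy'

/-! ### Isomorphisms from generating maps -/

/-- The sets `B a` are disjoint and cover only modulo null sets. Enumerating `A` and taking the
first `a` with `y ∈ B a` repairs overlaps, and a default value fills the rest. -/
theorem exists_measurable_comp_eq {X Y A : Type*} [MeasurableSpace X] [MeasurableSpace Y]
    [Countable A] [Nonempty A] [MeasurableSpace A] {μ : Measure X} (π : X → Y) (f : X → A)
    (h : ∀ a, ∃ B, MeasurableSet B ∧ f ⁻¹' {a} =ᵐ[μ] π ⁻¹' B) :
    ∃ s : Y → A, Measurable s ∧ ∀ᵐ x ∂μ, s (π x) = f x := by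
  classical
  obtain ⟨e, he⟩ := exists_injective_nat A
  choose B hB hfB using h
  set Q : Y → A → Prop := fun y a => y ∈ B a ∧ ∀ a', e a' < e a → y ∉ B a' with hQ
  have huniq : ∀ y a a', Q y a → Q y a' → a = a' := by
    intro y a a' h1 h2
    rcases lt_trichotomy (e a) (e a') with h | h | h
    · exact absurd h1.1 (h2.2 a h)
    · exact he h
    · exact absurd h2.1 (h1.2 a' h)
  set a₀ : A := Classical.arbitrary A
  set s : Y → A := fun y => if h : ∃ a, Q y a then h.choose else a₀ with hs
  have hsQ : ∀ y a, Q y a → s y = a := fun y a h => by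
    have hex : ∃ a, Q y a := ⟨a, h⟩
    rw [hs]
    dsimp only
    rw [dif_pos hex]
    exact huniq _ _ _ hex.choose_spec h
  have hQm : ∀ a, MeasurableSet {y | Q y a} := fun a => by
    have : {y | Q y a} = B a ∩ ⋂ a', ⋂ _ : e a' < e a, (B a')ᶜ := by
      ext y
      simp [hQ]
    rw [this]
    exact (hB a).inter (MeasurableSet.iInter fun a' => MeasurableSet.iInter fun _ => (hB a').compl)
  refine ⟨s, measurable_to_countable' fun a => ?_, ?_⟩
  · have : s ⁻¹' {a} = {y | Q y a} ∪ ((⋃ a', {y | Q y a'})ᶜ ∩ {y | a₀ = a}) := by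
      ext y
      by_cases hex : ∃ a', Q y a'
      · obtain ⟨a', ha'⟩ := hex
        simp only [Set.mem_preimage, Set.mem_singleton_iff, hsQ y a' ha', Set.mem_union,
          Set.mem_inter_iff, Set.mem_compl_iff, Set.mem_iUnion]
        constructor
        · rintro rfl
          exact Or.inl ha'
        · rintro (h | h)
          · exact huniq _ _ _ ha' h
          · exact absurd ⟨a', ha'⟩ h.1
      · have : s y = a₀ := dif_neg hex
        simp only [Set.mem_preimage, Set.mem_singleton_iff, this, Set.mem_union,
          Set.mem_inter_iff, Set.mem_compl_iff, Set.mem_iUnion]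
        exact ⟨fun h => Or.inr ⟨hex, h⟩, fun h => h.elim (fun h => absurd ⟨a, h⟩ hex) fun h => h.2⟩
    rw [this]
    exact (hQm a).union ((MeasurableSet.iUnion hQm).compl.inter (MeasurableSet.const _))
  · filter_upwards [ae_all_iff.2 hfB] with x hx
    have hx' : ∀ a, π x ∈ B a ↔ f x = a := fun a => (Eq.to_iff (hx a)).symm
    refine hsQ _ _ ⟨(hx' _).2 rfl, fun a' ha' hmem => ?_⟩
    rw [(hx' a').1 hmem] at ha'
    exact lt_irrefl _ ha'

theorem measurable_ofCoord (hP : P.IsAdmissible) {Y : Type*} [MeasurableSpace Y] {s : ℕ → Y → G}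
    (hs : ∀ n, Measurable (s n)) : Measurable fun y => P.ofCoord hP fun n => s n y := by
  refine measurable_of_box fun n a => ?_
  have hE : MeasurableSet {y | P.IsEventualPath fun n => s n y} := by
    have : {y | P.IsEventualPath fun n => s n y} =
        {y | ∀ᶠ n in atTop, s n y ∈ P.F n ∧ (s n y)⁻¹ * s (n + 1) y ∈ P.C n} := by
      ext y
      exact eventually_atTop.symm
    rw [this]
    exact measurableSet_setOf_eventually fun n => ((hs n).prodMk (hs (n + 1)))
      (MeasurableSet.of_discrete (s := {p : G × G | p.1 ∈ P.F n ∧ p.1⁻¹ * p.2 ∈ P.C n}))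
  by_cases ha : a ∈ P.F n
  · have : (fun y => P.ofCoord hP fun n => s n y) ⁻¹' P.box n a =
        ({y | P.IsEventualPath fun n => s n y} ∩
          {y | ∀ᶠ m in atTop, a⁻¹ * s m y ∈ blockSet P.C n m}) ∪
        ({y | P.IsEventualPath fun n => s n y}ᶜ ∩
          {y | P.point 0 (⟨1, hP.one_mem_F 0⟩, fun k => ⟨1, hP.one_mem_C k⟩) ∈ P.box n a}) := by
      ext y
      by_cases hy : P.IsEventualPath fun n => s n y
      · simp only [Set.mem_preimage, ofCoord_mem_box_iff hP hy ha]
        exact ⟨fun h => Or.inl ⟨hy, h⟩, fun h => h.elim (fun h => h.2) fun h => absurd hy h.1⟩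
      · rw [Set.mem_preimage, ofCoord, dif_neg hy]
        exact ⟨fun h => Or.inr ⟨hy, h⟩, fun h => h.elim (fun h => absurd h.1 hy) fun h => h.2⟩
    rw [this]
    refine (hE.inter (measurableSet_setOf_eventually fun m => ?_)).union
      (hE.compl.inter (MeasurableSet.const _))
    exact hs m (MeasurableSet.of_discrete (s := {g : G | a⁻¹ * g ∈ blockSet P.C n m}))
  · rw [box_eq_empty ha]
    exact MeasurableSet.empty

/-- An equivariant map that generates the Borel sets modulo null sets is an isomorphism onto its
image. -/
theorem isIsomorphicTo_map (hπ : Measurable π)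
    (he : ∀ g : G, ∀ᵐ x ∂(P.measure hP), π (P.T g x) = g • π x)
    (hgen : ∀ A, MeasurableSet A → ∃ B, MeasurableSet B ∧ A =ᵐ[P.measure hP] π ⁻¹' B) :
    P.IsIsomorphicTo hP Γ ((P.measure hP).toFinite.map π) := by
  -- Each coordinate of `x` is recovered from `π x` separately; the inverse map then reassembles the
  -- point from its coordinates.
  have hs : ∀ n, ∃ s : OdometerSpace Γ → G, Measurable s ∧
      ∀ᵐ x ∂(P.measure hP), s (π x) = P.coord n x := fun n =>
    exists_measurable_comp_eq π (P.coord n) fun a =>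
      hgen _ (measurable_coord hP n MeasurableSet.of_discrete)
  choose s hs hsπ using hs
  set σ : OdometerSpace Γ → P.Space := fun y => P.ofCoord hP fun n => s n y
  have hσ : Measurable σ := measurable_ofCoord hP hs
  have hσπ : ∀ᵐ x ∂(P.measure hP), σ (π x) = x := by
    filter_upwards [ae_all_iff.2 hsπ] with x hx
    change P.ofCoord hP (fun n => s n (π x)) = x
    simp only [hx]
    exact ofCoord_coord hP x
  refine ⟨π, σ, hπ, hσ, hσπ, ?_, he, (absolutelyContinuous_toFinite _).map hπ,
    (toFinite_absolutelyContinuous _).map hπ⟩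
  have hm : MeasurableSet {y | π (σ y) = y} := by
    have : {y | π (σ y) = y} = ⋂ n, {y | (π (σ y)).coord n = y.coord n} := by
      ext y
      rw [Set.mem_iInter]
      change π (σ y) = y ↔ _
      rw [OdometerSpace.ext_iff, funext_iff]
      rfl
    rw [this]
    exact MeasurableSet.iInter fun n =>
      (((OdometerSpace.measurable_coord n).comp (hπ.comp hσ)).prodMk
        (OdometerSpace.measurable_coord n))
        (MeasurableSet.of_discrete (s := {p : (G ⧸ Γ n) × (G ⧸ Γ n) | p.1 = p.2}))
  refine (ae_map_iff hπ.aemeasurable hm).2 ?_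
  refine toFinite_absolutelyContinuous (P.measure hP) ?_
  filter_upwards [hσπ] with x hx
  rw [hx]

end CFData

namespace CFData

variable {G : Type*} [Group G] [MeasurableSpace G] [DiscreteMeasurableSpace G] [Countable G]
  {P : CFData G} {Γ : ℕ → Subgroup G} {hP : P.IsAdmissible} {π : P.Space → OdometerSpace Γ}

/-! ### The approximation condition -/

/-- Carries the approximation condition over to the space: block products are the coordinates of the
points of the box of `1`. -/
theorem ν_symmDiff (hP : P.IsAdmissible) {n m : ℕ} (h : n ≤ m) (p : G → Prop) :
    P.ν m (symmDiff (blockSet P.C n m) {f | f ∈ P.F m ∧ p f}) =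
      P.measure hP (symmDiff (P.box n 1) (P.level m ∩ P.coord m ⁻¹' {f | p f})) := by
  rw [← measure_coord hP, box_one_eq hP h]
  congr 1
  ext x
  have := coord_mem_F hP m x
  simp only [Set.mem_inter_iff, Set.mem_preimage, Set.mem_symmDiff, Set.mem_ofPred_eq]
  tauto

/-- If the approximation condition does not fail, then the cylinders of `1` are, up to `ε`, preimages
of Borel sets under the limit map. -/
theorem exists_measure_symmDiff_le (hP : P.IsAdmissible) (hΓ : Antitone Γ) {q : ℕ → ℕ}
    (hq : StrictMono q) (hc : (P.telescope q).IsCompatible Γ)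
    (hA : ¬ (P.telescope q).ApproximationFails Γ) {n : ℕ} (hn : 0 < n) {ε : ℝ≥0∞} (hε : 0 < ε) :
    ∃ B, MeasurableSet B ∧
      P.measure hP (symmDiff (P.box (q n) 1) (P.limitMap hΓ q ⁻¹' B)) ≤ ε := by
  unfold ApproximationFails at hA
  push Not at hA
  obtain ⟨l, D, M, hM, hD⟩ := hA n hn ε hε
  refine ⟨{y | y.coord l ∈ D}, OdometerSpace.measurable_coord l MeasurableSet.of_discrete, ?_⟩
  set Z : ℕ → Set P.Space := fun m =>
    symmDiff (P.box (q n) 1) (P.level (q m) ∩ P.coord (q m) ⁻¹' {f | (f : G ⧸ Γ l) ∈ D})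
  have hZ : ∀ m, M < m → P.measure hP (Z m) ≤ ε := by
    intro m hm
    have hnm : n ≤ m := by omega
    have := hD m hm
    change P.ν (q m) (symmDiff (blockSet (fun k => blockSet P.C (q k) (q (k + 1))) n m)
      {f | f ∈ P.F (q m) ∧ (f : G ⧸ Γ l) ∈ D}) ≤ ε at this
    rwa [blockSet_comp _ hq.monotone hnm, ν_symmDiff hP (hq.monotone hnm)] at this
  -- Almost every point of the limiting symmetric difference lies in all `Z m` with `m` large, since
  -- the cosets stabilize. The sets `W N` increase, so their union still has measure at most `ε`.
  set W : ℕ → Set P.Space := fun N => ⋂ m, ⋂ _ : N ≤ m, Z m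
  have hW : Monotone W := fun N N' h =>
    Set.iInter_mono fun m => Set.iInter_mono' fun hm => ⟨h.trans hm, le_rfl⟩
  have hWε : P.measure hP (⋃ N, W N) ≤ ε := by
    rw [hW.measure_iUnion]
    refine iSup_le fun N => (measure_mono ?_).trans (hZ (max (M + 1) N) (by omega))
    exact Set.iInter₂_subset _ (le_max_right _ _)
  refine le_trans (measure_mono_ae ?_) hWε
  filter_upwards [ae_stabilizes hP hΓ hq hc] with x hx hx'
  have h1 := hx.eventually_eq hΓ l
  have h2 := hq.tendsto_atTop.eventually (eventually_mem_level hP x)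
  obtain ⟨N, hN⟩ := eventually_atTop.1 (h1.and h2)
  refine Set.mem_iUnion.2 ⟨N, Set.mem_iInter₂.2 fun m hm => ?_⟩
  obtain ⟨h3, h4⟩ := hN m hm
  have h5 : x ∈ P.level (q m) ∩ P.coord (q m) ⁻¹' {f | (f : G ⧸ Γ l) ∈ D} ↔
      x ∈ P.limitMap hΓ q ⁻¹' {y | y.coord l ∈ D} := by
    simp only [Set.mem_inter_iff, h4, true_and, Set.mem_preimage, Set.mem_ofPred_eq, h3]
  change x ∈ symmDiff (_ : Set P.Space) _ at hx'
  rw [Set.mem_symmDiff] at hx' ⊢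
  rwa [h5]

/-- The `σ`-algebra of the sets that are, modulo null sets, preimages of measurable sets. -/
abbrev aePreimageSpace {X Y : Type*} [MeasurableSpace X] [MeasurableSpace Y] (μ : Measure X)
    (π : X → Y) : MeasurableSpace X :=
  eventuallyMeasurableSpace (MeasurableSpace.comap π inferInstance) (ae μ)

theorem measurableSet_aePreimageSpace_iff {X Y : Type*} [MeasurableSpace X] [MeasurableSpace Y]
    {μ : Measure X} {π : X → Y} {A : Set X} : MeasurableSet[aePreimageSpace μ π] A ↔
      ∃ B, MeasurableSet B ∧ A =ᵐ[μ] π ⁻¹' B := by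
  constructor
  · rintro ⟨_, ⟨B, hB, rfl⟩, h⟩
    exact ⟨B, hB, h⟩
  · rintro ⟨B, hB, h⟩
    exact ⟨_, ⟨B, hB, rfl⟩, h⟩

/-- With errors `2⁻¹ ^ k`, Borel–Cantelli makes membership in `B k` eventually equivalent to
membership in `A`, so the lower limit of the `B k` works. -/
theorem exists_ae_eq_preimage_of_approx {X Y : Type*} [MeasurableSpace X] [MeasurableSpace Y]
    {μ : Measure X} {π : X → Y} {A : Set X}
    (h : ∀ ε : ℝ≥0∞, 0 < ε → ∃ B, MeasurableSet B ∧ μ (symmDiff A (π ⁻¹' B)) ≤ ε) :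
    ∃ B, MeasurableSet B ∧ A =ᵐ[μ] π ⁻¹' B := by
  choose B hB hle using fun k : ℕ => h (2⁻¹ ^ k) (pos_of_ne_zero (by simp))
  refine ⟨{y | ∀ᶠ k in atTop, y ∈ B k}, measurableSet_setOf_eventually hB, ?_⟩
  have hsum : ∑' k, μ (symmDiff A (π ⁻¹' B k)) ≠ ∞ := by
    refine ne_top_of_le_ne_top ?_ (ENNReal.tsum_le_tsum hle)
    rw [ENNReal.tsum_geometric, ENNReal.one_sub_inv_two, inv_inv]
    exact ENNReal.ofNat_ne_top
  filter_upwards [ae_eventually_notMem hsum] with x hx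
  have h1 : ∀ᶠ k in atTop, (π x ∈ B k ↔ x ∈ A) := by
    filter_upwards [hx] with k hk
    rw [Set.mem_symmDiff, Set.mem_preimage] at hk
    tauto
  refine propext ⟨fun hxA => ?_, fun hxB => ?_⟩
  · exact h1.mono fun k hk => hk.2 hxA
  · obtain ⟨k, hk1, hk2⟩ := (h1.and hxB).exists
    exact hk1.1 hk2

theorem exists_ae_eq_preimage_box
    (he : ∀ g : G, ∀ᵐ x ∂(P.measure hP), π (P.T g x) = g • π x) {n : ℕ}
    (h : ∃ B, MeasurableSet B ∧ P.box n 1 =ᵐ[P.measure hP] π ⁻¹' B) {f : G} (hf : f ∈ P.F n) :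
    ∃ B, MeasurableSet B ∧ P.box n f =ᵐ[P.measure hP] π ⁻¹' B := by
  obtain ⟨B, hB, hBx⟩ := h
  refine ⟨(fun y => f⁻¹ • y) ⁻¹' B, OdometerSpace.measurable_smul f⁻¹ hB, ?_⟩
  filter_upwards [he f⁻¹, (quasiMeasurePreserving_T hP f⁻¹).ae hBx, ae_mem_dom hP f⁻¹] with x h1 h2 h3
  have h4 : P.T f⁻¹ x ∈ P.box n 1 ↔ f⁻¹ • π x ∈ B := by
    rw [← h1]
    exact Eq.to_iff h2
  refine propext ((?_ : x ∈ P.box n f ↔ _).trans h4)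
  constructor
  · intro hx
    have := T_mem_box (g := f⁻¹) hx (by simpa using hP.one_mem_F n)
    rwa [inv_mul_cancel] at this
  · intro hx
    have := mem_box_of_T_mem_box hP h3 (by simpa using hf) hx
    rwa [inv_inv, mul_one] at this

/-- The limit map of a compatible telescoping generates the Borel sets modulo null sets, if the
approximation condition does not fail. -/
theorem exists_ae_eq_preimage_limitMap (hP : P.IsAdmissible) (hΓ : Antitone Γ) {q : ℕ → ℕ}
    (hq : StrictMono q) (hc : (P.telescope q).IsCompatible Γ)
    (hA : ¬ (P.telescope q).ApproximationFails Γ) {A : Set P.Space} (hAm : MeasurableSet A) :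
    ∃ B, MeasurableSet B ∧ A =ᵐ[P.measure hP] P.limitMap hΓ q ⁻¹' B := by
  set π := P.limitMap hΓ q
  have hbox : ∀ n, 0 < n → ∀ f, MeasurableSet[aePreimageSpace (P.measure hP) π] (P.box (q n) f) := by
    intro n hn f
    by_cases hf : f ∈ P.F (q n)
    · refine measurableSet_aePreimageSpace_iff.2
        (exists_ae_eq_preimage_box (limitMap_T hP hΓ hq hc) ?_ hf)
      exact exists_ae_eq_preimage_of_approx fun ε hε =>
        exists_measure_symmDiff_le hP hΓ hq hc hA hn hε
    · rw [box_eq_empty hf]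
      exact @MeasurableSet.empty _ (aePreimageSpace _ _)
  have hle : P.instMeasurableSpaceSpace ≤ aePreimageSpace (P.measure hP) π := by
    refine generateFrom_box.le.trans (MeasurableSpace.generateFrom_le ?_)
    rintro _ ⟨j, a, rfl⟩
    by_cases ha : a ∈ P.F j
    · have hj : j ≤ q (j + 1) := (Nat.le_succ j).trans hq.le_apply
      rw [box_eq_iUnion hP hj ha]
      exact @MeasurableSet.iUnion _ _ (aePreimageSpace _ _) _ _ fun b =>
        @MeasurableSet.iUnion _ _ (aePreimageSpace _ _) _ _ fun _ =>
        hbox (j + 1) (Nat.succ_pos j) _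
    · rw [box_eq_empty ha]
      exact @MeasurableSet.empty _ (aePreimageSpace _ _)
  exact measurableSet_aePreimageSpace_iff.1 (hle A hAm)

theorem isFiniteMeasure_measure (hP : P.IsAdmissible) (h : (⨆ n, P.ν n (P.F n)) < ∞) :
    IsFiniteMeasure (P.measure hP) := by
  refine ⟨?_⟩
  rw [← iUnion_level hP, (level_mono hP).measure_iUnion]
  simpa only [measure_level] using h

/-- For an isomorphism with an odometer and the associated compatible telescoping, the approximation
condition does not fail. -/
theorem not_approximationFails (hfin : (⨆ n, P.ν n (P.F n)) < ∞) {σ : OdometerSpace Γ → P.Space}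
    (hπ : Measurable π) (hσ : Measurable σ)
    (he : ∀ g : G, ∀ᵐ x ∂(P.measure hP), π (P.T g x) = g • π x)
    (hσπ : ∀ᵐ x ∂(P.measure hP), σ (π x) = x) {y : OdometerSpace Γ} {q : ℕ → ℕ}
    (hq : StrictMono q)
    (hd : ∀ k, 1 ≤ k → ∀ l, l ≤ k → P.defect hP π (q k) l (y.coord l) ≤ 2⁻¹ ^ (k + 1)) :
    ¬ (P.telescope q).ApproximationFails y.stab := by
  rintro ⟨n, hn, ε, hε, h⟩
  have := isFiniteMeasure_measure hP hfin
  have hε2 : ε / 2 ≠ 0 := by simp [hε.ne']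
  obtain ⟨l, D₀, hD₀⟩ := OdometerSpace.exists_approx ((P.measure hP).map π)
    (hσ (measurableSet_box (q n) (1 : G))) hε2
  have hDm : MeasurableSet {z : OdometerSpace Γ | z.coord l ∈ D₀} :=
    OdometerSpace.measurable_coord l MeasurableSet.of_discrete
  rw [Measure.map_apply hπ ((hσ (measurableSet_box _ _)).symmDiff hDm)] at hD₀
  set E : Set P.Space := {x | (π x).coord l ∈ D₀}
  have hE : P.measure hP (symmDiff (P.box (q n) 1) E) ≤ ε / 2 := by
    refine le_trans (measure_mono_ae ?_) hD₀
    filter_upwards [hσπ] with x hx hx'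
    change x ∈ symmDiff (_ : Set P.Space) _ at hx'
    change π x ∈ symmDiff (_ : Set (OdometerSpace Γ)) _
    rw [Set.mem_symmDiff] at hx' ⊢
    rwa [Set.mem_preimage, hx]
  have hlim : Tendsto (fun m : ℕ => (2⁻¹ : ℝ≥0∞) ^ (m + 1) * P.measure hP Set.univ) atTop (𝓝 0) := by
    have h1 := (ENNReal.tendsto_pow_atTop_nhds_zero_of_lt_one
      (show (2⁻¹ : ℝ≥0∞) < 1 by simp)).comp (tendsto_add_atTop_nat 1)
    have h2 := ENNReal.Tendsto.mul_const h1 (Or.inr (measure_ne_top (P.measure hP) Set.univ))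
    rwa [zero_mul] at h2
  obtain ⟨M, hM⟩ := eventually_atTop.1 (hlim.eventually (ge_mem_nhds (pos_of_ne_zero hε2)))
  -- `D₀` consists of cosets of `Γ l`, whereas `D` must consist of cosets of the stabilizer; the
  -- orbit map `f ↦ f • y.coord l` identifies the two.
  set D : Set (G ⧸ y.stab l) := {a | ∃ f : G, a = (f : G ⧸ y.stab l) ∧ f • y.coord l ∈ D₀}
  have hD : ∀ f : G, (f : G ⧸ y.stab l) ∈ D ↔ f • y.coord l ∈ D₀ := by
    intro f
    constructor
    · rintro ⟨f', h1, h2⟩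
      rw [QuotientGroup.eq, y.mem_stab_iff, mul_smul, inv_smul_eq_iff] at h1
      rwa [← h1]
    · exact fun h1 => ⟨f, rfl, h1⟩
  -- `m` exceeds `M` for a small error, `l` so that the defect bound covers the coordinate `l`, and
  -- `n` so that the block product makes sense.
  obtain ⟨m, hm, hlt⟩ := h l D (max M (max l n) + 1) (by omega)
  have hnm : n ≤ m := by omega
  change ε < P.ν (q m) (symmDiff (blockSet (fun k => blockSet P.C (q k) (q (k + 1))) n m)
    {f | f ∈ P.F (q m) ∧ (f : G ⧸ y.stab l) ∈ D}) at hlt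
  rw [blockSet_comp _ hq.monotone hnm, ν_symmDiff hP (hq.monotone hnm)] at hlt
  -- Off `V` the coordinate `l` of `π x` is `f • y.coord l`, where `f` is the `F (q m)`-coordinate
  -- of `x`, so membership in `E` is decided by the coset of `f`.
  set V : Set P.Space := {x | (π x).coord l ≠ P.coord (q m) x • y.coord l}
  have hV : MeasurableSet V :=
    ((measurable_coord hP (q m)).prodMk ((OdometerSpace.measurable_coord l).comp hπ))
      (MeasurableSet.of_discrete (s := {p : G × (G ⧸ Γ l) | p.2 ≠ p.1 • y.coord l}))
  have hVle : P.measure hP (P.level (q m) ∩ P.coord (q m) ⁻¹' P.F (q m) ∩ V) ≤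
      2⁻¹ ^ (m + 1) * P.ν (q m) (P.F (q m)) := by
    refine measure_le_mul_ν hP hV fun f hf => ?_
    have : P.box (q m) f ∩ V = P.box (q m) f ∩ {x | (π x).coord l ≠ f • y.coord l} := by
      ext x
      refine and_congr_right fun hx => ?_
      change _ ≠ _ ↔ _ ≠ _
      rw [coord_eq hP hx]
    rw [this, measure_box_inter_ne hπ he hf]
    exact mul_le_mul_left (hd m (by omega) l (by omega)) _
  refine absurd hlt (not_lt.2 ?_)
  calc _ ≤ P.measure hP (symmDiff (P.box (q n) 1) E ∪
        (P.level (q m) ∩ P.coord (q m) ⁻¹' P.F (q m) ∩ V)) := by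
        refine measure_mono fun x hx => ?_
        by_cases hxm : x ∈ P.level (q m)
        · by_cases hxV : (π x).coord l = P.coord (q m) x • y.coord l
          · left
            have h1 : x ∈ P.level (q m) ∩ P.coord (q m) ⁻¹' {f | (f : G ⧸ y.stab l) ∈ D} ↔
                x ∈ E := by
              simp only [Set.mem_inter_iff, hxm, true_and, Set.mem_preimage, Set.mem_ofPred_eq, hD,
                E, hxV]
            rw [Set.mem_symmDiff] at hx ⊢
            rwa [h1] at hx
          · exact Or.inr ⟨⟨hxm, coord_mem_F hP _ x⟩, hxV⟩
        · exfalso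
          rcases hx with ⟨h1, -⟩ | ⟨h1, -⟩
          · exact hxm (level_mono hP (hq.monotone hnm) ⟨_, h1⟩)
          · exact hxm h1.1
    _ ≤ ε / 2 + 2⁻¹ ^ (m + 1) * P.measure hP Set.univ := by
        refine (measure_union_le _ _).trans (add_le_add hE (hVle.trans ?_))
        rw [← measure_level hP]
        exact mul_le_mul_right (measure_mono (Set.subset_univ _)) _
    _ ≤ ε / 2 + ε / 2 := add_le_add_right (hM m (by omega)) _
    _ = ε := ENNReal.add_halves ε

end CFData

/-! ### The equivalences -/

theorem corollary4p6 {G : Type*} [Group G] [Countable G] [MeasurableSpace G]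
    [DiscreteMeasurableSpace G] (P : CFData G) (hP : P.IsAdmissible) :
    -- the criterion for having no odometer factor
    ((¬ ∃ (Γ : ℕ → Subgroup G) (ν : Measure (OdometerSpace Γ)),
        IsOdometerSequence Γ ∧ IsNonsingularOdometer Γ ν ∧ P.HasFactor hP Γ ν) ↔
      ∀ Γ : ℕ → Subgroup G, IsOdometerSequence Γ →
        ∀ q : ℕ → ℕ, q 0 = 0 → StrictMono q → ¬ (P.telescope q).IsCompatible Γ) ∧
    -- the same for factors with a non-atomic measure
    ((∀ Γ : ℕ → Subgroup G, IsOdometerSequence Γ → (⋂ n, (Γ n : Set G)).Finite) →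
      ((¬ ∃ (Γ : ℕ → Subgroup G) (ν : Measure (OdometerSpace Γ)),
          IsOdometerSequence Γ ∧ IsNonsingularOdometer Γ ν ∧ NullSingletonClass ν ∧
            P.HasFactor hP Γ ν) ↔
        ∀ Γ : ℕ → Subgroup G, IsOdometerSequence Γ →
          ∀ q : ℕ → ℕ, q 0 = 0 → StrictMono q → ¬ (P.telescope q).IsCompatible Γ)) ∧
    -- the criterion for not being isomorphic to an odometer
    ((¬ ∃ (Γ : ℕ → Subgroup G) (ν : Measure (OdometerSpace Γ)),
        IsOdometerSequence Γ ∧ IsNonsingularOdometer Γ ν ∧ P.IsIsomorphicTo hP Γ ν) →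
      ∀ Γ : ℕ → Subgroup G, IsOdometerSequence Γ →
        ∀ q : ℕ → ℕ, q 0 = 0 → StrictMono q → (P.telescope q).IsCompatible Γ →
          (P.telescope q).ApproximationFails Γ) ∧
    ((⨆ n, P.ν n (P.F n)) < ∞ →
      (∀ Γ : ℕ → Subgroup G, IsOdometerSequence Γ →
        ∀ q : ℕ → ℕ, q 0 = 0 → StrictMono q → (P.telescope q).IsCompatible Γ →
          (P.telescope q).ApproximationFails Γ) →
      ¬ ∃ (Γ : ℕ → Subgroup G) (ν : Measure (OdometerSpace Γ)),
        IsOdometerSequence Γ ∧ IsNonsingularOdometer Γ ν ∧ P.IsIsomorphicTo hP Γ ν) := by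
  have hfactor : ∀ Γ : ℕ → Subgroup G, IsOdometerSequence Γ →
      ∀ π : P.Space → OdometerSpace Γ, Measurable π →
        (∀ g : G, ∀ᵐ x ∂(P.measure hP), π (P.T g x) = g • π x) →
        ∃ Γ' : ℕ → Subgroup G, IsOdometerSequence Γ' ∧ ∃ q : ℕ → ℕ, q 0 = 0 ∧ StrictMono q ∧
          (P.telescope q).IsCompatible Γ' := by
    intro Γ hΓ π hπ he
    obtain ⟨y, q, hq0, hq, hc, -⟩ := CFData.exists_compatible hΓ hπ he
    exact ⟨y.stab, y.isOdometerSequence_stab hΓ, q, hq0, hq, hc⟩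
  refine ⟨⟨?_, ?_⟩, fun hfin => ⟨?_, ?_⟩, ?_, ?_⟩
  · intro h Γ hΓ q _ hq hc
    have hanti := hΓ.strictAnti.antitone
    have hπ := CFData.measurable_limitMap hP hanti q
    have he := CFData.limitMap_T hP hanti hq hc
    exact h ⟨Γ, _, hΓ, CFData.isNonsingularOdometer_map hP hπ he, CFData.hasFactor_map hP hπ he⟩
  · rintro h ⟨Γ, ν, hΓ, -, π, hπ, he, -⟩
    obtain ⟨Γ', hΓ', q, hq0, hq, hc⟩ := hfactor Γ hΓ π hπ he
    exact h Γ' hΓ' q hq0 hq hc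
  · intro h Γ hΓ q _ hq hc
    have hanti := hΓ.strictAnti.antitone
    have hπ := CFData.measurable_limitMap hP hanti q
    have he := CFData.limitMap_T hP hanti hq hc
    exact h ⟨Γ, _, hΓ, CFData.isNonsingularOdometer_map hP hπ he,
      -- The finiteness hypothesis is applied to the stabilizers of the coordinates of each `y`, not
      -- to `Γ` itself.
      CFData.nullSingletonClass_map hπ he fun y => hfin _ (y.isOdometerSequence_stab hΓ),
      CFData.hasFactor_map hP hπ he⟩
  · rintro h ⟨Γ, ν, hΓ, -, -, π, hπ, he, -⟩
    obtain ⟨Γ', hΓ', q, hq0, hq, hc⟩ := hfactor Γ hΓ π hπ he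
    exact h Γ' hΓ' q hq0 hq hc
  · intro h Γ hΓ q _ hq hc
    by_contra hA
    have hanti := hΓ.strictAnti.antitone
    have hπ := CFData.measurable_limitMap hP hanti q
    have he := CFData.limitMap_T hP hanti hq hc
    exact h ⟨Γ, _, hΓ, CFData.isNonsingularOdometer_map hP hπ he, CFData.isIsomorphicTo_map hπ he
      fun A hAm => CFData.exists_ae_eq_preimage_limitMap hP hanti hq hc hA hAm⟩
  · rintro hμ h ⟨Γ, ν, hΓ, -, π, σ, hπ, hσ, hσπ, -, he, -⟩
    obtain ⟨y, q, hq0, hq, hc, hd⟩ := CFData.exists_compatible hΓ hπ he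
    -- The condition is contradicted for the conjugate sequence `y.stab`, with which the telescoping
    -- is compatible.
    exact CFData.not_approximationFails hμ hπ hσ he hσπ hq hd
      (h y.stab (y.isOdometerSequence_stab hΓ) q hq0 hq hc)
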